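/- Let $N\ge 0$ and, for $Y\in\mathbb R^{N\times N}$, define the Sinkhorn iterates by $\mathcal S^0(Y)=\exp(Y)$ (entrywise) and $\mathcal S^{k}(Y)=\mathcal T_c(\mathcal T_r(\mathcal S^{k-1}(Y)))$ for $k\ge 1$, where $\mathcal T_r$ divides every entry by the sum of its row and $\mathcal T_c$ divides every entry by the sum of its column; let $\mathcal S(Y)=\lim_{k\to\infty}\mathcal S^k(Y)$. Write $\|\cdot\|$ for the Frobenius norm. A number $r\in(0,1)$ is called a rate of convergence of the Sinkhorn iteration at $Y$ if $\mathcal S^k(Y)\to\mathcal S(Y)$ and $\|\mathcal S^k(Y)-\mathcal S(Y)\|\le C' r^k$ for all $k$, for some constant $C'$ (which may depend on $Y$ and $r$). An optimal assignment for a reward matrix $R$ is a permutation matrix $P$ maximizing $\sum_{i,j}R_{ij}P_{ij}$ over all permutation matrices; the Hungarian algorithm applied to $R$ returns such a matrix. (i) If $X\in\mathbb R^{N\times N}$ and $\epsilon$ is an $N\times N$ matrix of independent standard Gumbel random variables, then almost surely $Y=X+\epsilon$ has a unique optimal assignment. (ii) Let $Y\in\mathbb R^{N\times N}$ have a unique optimal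 assignment. Then for every $\tau>0$ the Sinkhorn iteration at $Y/\tau$ has a rate of convergence $r\in(0,1)$. Moreover, there are a function $\tau\mapsto s_\tau$ with $s_\tau\to0$ as $\tau\to0^+$ and constants $C$, $k_0$ and $\tau_0>0$ such that, for all $0<\tau<\tau_0$, every rate of convergence $r\in(0,1)$ of the Sinkhorn iteration at $Y/\tau$, all $k\ge k_0$, and every optimal assignment $P_{\mathrm{real}}$ for the reward matrix $P_{\mathrm{GS}}=\mathcal S^k(Y/\tau)$, $$\|P_{\mathrm{real}}-P_{\mathrm{GS}}\|^2\le C\,\bigl(s_\tau^2+r^{2k}\bigr).$$ Here $r$ may depend on $\tau$, while $s$, $C$, $k_0$ and $\tau_0$ depend on $Y$ only. -/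

import Mathlib

open Filter Topology MeasureTheory ProbabilityTheory
open scoped Matrix.Norms.Frobenius

noncomputable section

/-- Row-wise normalization: every entry is divided by the sum of its row. -/
def rowNormalize {N : ℕ} (A : Matrix (Fin N) (Fin N) ℝ) : Matrix (Fin N) (Fin N) ℝ :=
  Matrix.of fun i j => A i j / ∑ l, A i l

/-- Column-wise normalization: every entry is divided by the sum of its column. -/
def colNormalize {N : ℕ} (A : Matrix (Fin N) (Fin N) ℝ) : Matrix (Fin N) (Fin N) ℝ :=
  Matrix.of fun i j => A i j / ∑ l, A l j

/-- The Sinkhorn iterates `S^k(X)`: `S^0(X)` is the entrywise exponential, and each step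
normalizes the rows and then the columns. -/
def sinkhornIter {N : ℕ} (X : Matrix (Fin N) (Fin N) ℝ) : ℕ → Matrix (Fin N) (Fin N) ℝ
  | 0 => X.map Real.exp
  | k + 1 => colNormalize (rowNormalize (sinkhornIter X k))

/-- `L` is the value of the Sinkhorn operator at `X`, the entrywise limit of the iterates. -/
def IsSinkhornLimit {N : ℕ} (X L : Matrix (Fin N) (Fin N) ℝ) : Prop :=
  ∀ i j, Tendsto (fun k => sinkhornIter X k i j) atTop (𝓝 (L i j))

/-- `r ∈ (0, 1)` is a rate of convergence of the Sinkhorn iteration started from `X`: the iterates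
converge to the value `L` of the Sinkhorn operator, with Frobenius error `O(r ^ k)`. -/
def IsSinkhornRate {N : ℕ} (X : Matrix (Fin N) (Fin N) ℝ) (r : ℝ) : Prop :=
  0 < r ∧ r < 1 ∧ ∃ L, IsSinkhornLimit X L ∧ ∃ C : ℝ, ∀ k, ‖sinkhornIter X k - L‖ ≤ C * r ^ k

/-- The total reward `∑ i j, R i j * P i j` of the assignment matrix `P` for the reward
matrix `R`. -/
def assignmentReward {N : ℕ} (R P : Matrix (Fin N) (Fin N) ℝ) : ℝ :=
  ∑ i, ∑ j, R i j * P i j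

/-- `P` is an optimal solution of the assignment problem with reward matrix `R`, that is, a
permutation matrix of maximal reward. The Hungarian algorithm returns such a matrix; which one it
returns in the presence of ties depends on its implementation. -/
def IsOptimalAssignment {N : ℕ} (R P : Matrix (Fin N) (Fin N) ℝ) : Prop :=
  (∃ σ : Equiv.Perm (Fin N), P = σ.permMatrix ℝ) ∧
    ∀ σ : Equiv.Perm (Fin N), assignmentReward R (σ.permMatrix ℝ) ≤ assignmentReward R P

/-- `Z` is a random variable with the standard Gumbel distribution, whose distribution function is
`t ↦ exp (-exp (-t))`. -/
structure IsStandardGumbel {Ω : Type*} [MeasurableSpace Ω] (Z : Ω → ℝ) (μ : Measure Ω) :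
    Prop where
  aemeasurable : AEMeasurable Z μ
  cdf_eq : ∀ t : ℝ, μ {ω | Z ω ≤ t} = ENNReal.ofReal (Real.exp (-Real.exp (-t)))

end

/-! ### Almost sure uniqueness of the optimal assignment -/

/-! Uniqueness: the rewards of two distinct permutations differ by a constant plus a nontrivial
linear combination of independent atomless variables, so each of the finitely many possible ties is
a null event.

Existence of a rate: row and column scalings preserve cross ratios, so the iterates from the first
on have entries bounded away from zero. Each normalization then averages the inverse marginals with
weights bounded below, and the relative spread of the row sums contracts geometrically
(`colSum_rowNormalize_contract`, `exists_rowSum_geometric_bounds`).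

The estimate: the constant attached to a rate may depend on the temperature, so `r ^ k` alone does
not control the iterates uniformly. Instead, `r` itself is forced to be close to one. Let `σ` be the
optimal permutation and `g` its gap to the second best. Ratios of products along permutations are
invariant under scaling, so by Birkhoff's theorem the limit is within order `exp (-g / (τ N))` of
the matrix of `σ`. Near a permutation matrix, normalization barely averages, and the oscillation of
the row sums decays slowly: every rate is at least `1 - 8 η` with `η = rateGap N g τ`, unless the
iterates are doubly stochastic from the first one on (`IsSinkhornRate.doublyStochastic_or_le`).

If `16 η (k + 1) ≤ 1` and the iterate of index `k + 1` is not doubly stochastic, then `r ^ (2 * (k +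
1))` is at least `1 / 4` and the trivial bound `N` on the distance suffices. Otherwise, if that
iterate is not already doubly stochastic, `k` is exponentially large in `1 / τ`, while the logarithm
of the product along `σ`, which is nondecreasing, has only order `1 / τ` left to gain; hence the row
sums are close to one, and compactness puts the iterate close to the matrix of `σ`
(`eventually_norm_sub_le_of_isLateIterate`). An optimal assignment for the iterate is at least as
close to it as `σ`. -/

lemma IsStandardGumbel.measure_eq_zero {Ω : Type*} [MeasurableSpace Ω] {μ : Measure Ω}
    [IsProbabilityMeasure μ] {Z : Ω → ℝ} (hZ : IsStandardGumbel Z μ) (t : ℝ) :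
    μ {ω | Z ω = t} = 0 := by
  have hF : Continuous fun t : ℝ => ENNReal.ofReal (Real.exp (-Real.exp (-t))) :=
    ENNReal.continuous_ofReal.comp (by fun_prop)
  have key : ∀ s < t, μ {ω | Z ω = t} ≤
      ENNReal.ofReal (Real.exp (-Real.exp (-t))) - ENNReal.ofReal (Real.exp (-Real.exp (-s))) := by
    intro s hs
    have hd : Disjoint {ω | Z ω = t} {ω | Z ω ≤ s} := by
      rw [Set.disjoint_left]
      rintro ω (h : Z ω = t) (h' : Z ω ≤ s)
      linarith
    have hm : NullMeasurableSet {ω | Z ω ≤ s} μ := hZ.aemeasurable.nullMeasurable measurableSet_Iic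
    have hu : μ {ω | Z ω = t} + μ {ω | Z ω ≤ s} ≤ μ {ω | Z ω ≤ t} := by
      rw [← measure_union₀ hm hd.aedisjoint]
      apply measure_mono
      rintro ω (h | h)
      · exact le_of_eq h
      · exact le_trans h hs.le
    rw [hZ.cdf_eq, hZ.cdf_eq] at hu
    exact ENNReal.le_sub_of_add_le_right ENNReal.ofReal_ne_top hu
  have hlim : Tendsto (fun s : ℝ => ENNReal.ofReal (Real.exp (-Real.exp (-t))) -
      ENNReal.ofReal (Real.exp (-Real.exp (-s)))) (𝓝[<] t) (𝓝 0) := by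
    have h := ENNReal.Tendsto.sub (tendsto_const_nhds (f := 𝓝[<] t)
      (x := ENNReal.ofReal (Real.exp (-Real.exp (-t)))))
      ((hF.tendsto t).mono_left nhdsWithin_le_nhds) (Or.inl ENNReal.ofReal_ne_top)
    simpa using h
  exact le_antisymm (ge_of_tendsto hlim (eventually_mem_nhdsWithin.mono key)) bot_le

/-- Fubini: once `U` is fixed, `V` has to hit a single point. -/
lemma ProbabilityTheory.IndepFun.measure_add_eq_zero {Ω : Type*} [MeasurableSpace Ω]
    {μ : Measure Ω} [IsProbabilityMeasure μ] {U V : Ω → ℝ} (h : IndepFun U V μ)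
    (hU : AEMeasurable U μ) (hV : AEMeasurable V μ) (hV0 : ∀ t, μ {ω | V ω = t} = 0) (c : ℝ) :
    μ {ω | U ω + V ω = c} = 0 := by
  have hs : MeasurableSet {p : ℝ × ℝ | p.1 + p.2 = c} :=
    measurableSet_eq_fun (by fun_prop) (by fun_prop)
  have h1 : μ {ω | U ω + V ω = c} = μ.map (fun ω => (U ω, V ω)) {p : ℝ × ℝ | p.1 + p.2 = c} := by
    rw [Measure.map_apply_of_aemeasurable (hU.prodMk hV) hs]
    rfl
  have := Measure.isProbabilityMeasure_map hU (μ := μ)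
  have := Measure.isProbabilityMeasure_map hV (μ := μ)
  rw [h1, (indepFun_iff_map_prod_eq_prod_map_map hU hV).1 h, Measure.prod_apply hs]
  have : ∀ u, μ.map V (Prod.mk u ⁻¹' {p : ℝ × ℝ | p.1 + p.2 = c}) = 0 := by
    intro u
    rw [Measure.map_apply_of_aemeasurable hV (measurable_prodMk_left hs), ← hV0 (c - u)]
    congr 1
    ext ω
    simp only [Set.mem_preimage, Set.mem_ofPred_eq]
    constructor <;> intro h <;> linarith
  simp_rw [this, lintegral_zero]

lemma ProbabilityTheory.iIndepFun.measure_weighted_sum_eq_zero {Ω ι : Type*} [MeasurableSpace Ω]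
    [Fintype ι] {μ : Measure Ω} [IsProbabilityMeasure μ] {f : ι → Ω → ℝ} (h : iIndepFun f μ)
    (hf : ∀ i, AEMeasurable (f i) μ) (h0 : ∀ i t, μ {ω | f i ω = t} = 0) {w : ι → ℝ} {i : ι}
    (hi : w i ≠ 0) (c : ℝ) : μ {ω | ∑ j, w j * f j ω = c} = 0 := by
  classical
  have hm : ∀ j, AEMeasurable (fun ω => w j * f j ω) μ := fun j => (hf j).const_mul _
  have hg : iIndepFun (fun j ω => w j * f j ω) μ :=
    h.comp (fun j x => w j * x) fun j => measurable_const_mul _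
  have hind := hg.indepFun_finsetSum_of_notMem₀ hm (Finset.notMem_erase i Finset.univ)
  have key := hind.measure_add_eq_zero (Finset.aemeasurable_sum _ fun j _ => hm j) (hm i)
    (fun t => by
      rw [← h0 i (t / w i)]
      congr 1
      ext ω
      simp only [Set.mem_ofPred_eq]
      rw [eq_div_iff hi, mul_comm]) c
  rw [← key]
  congr 1
  ext ω
  simp only [Set.mem_ofPred_eq, Finset.sum_apply]
  rw [Finset.sum_erase_add _ _ (Finset.mem_univ i)]

lemma permMatrix_apply' {N : ℕ} (σ : Equiv.Perm (Fin N)) (i j : Fin N) :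
    σ.permMatrix ℝ i j = if σ i = j then 1 else 0 := by
  simp [Equiv.Perm.permMatrix, PEquiv.toMatrix_apply, Equiv.toPEquiv_apply, eq_comm]

lemma permMatrix_injective {N : ℕ} {σ π : Equiv.Perm (Fin N)}
    (h : σ.permMatrix ℝ = π.permMatrix ℝ) : σ = π := by
  ext i
  have := congrFun (congrFun h i) (π i)
  rw [permMatrix_apply', permMatrix_apply'] at this
  simp only [if_true] at this
  by_contra hne
  rw [if_neg (fun h => hne (congrArg _ h))] at this
  exact zero_ne_one this

lemma assignmentReward_permMatrix {N : ℕ} (R : Matrix (Fin N) (Fin N) ℝ)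
    (σ : Equiv.Perm (Fin N)) : assignmentReward R (σ.permMatrix ℝ) = ∑ i, R i (σ i) := by
  simp [assignmentReward]

lemma existsUnique_isOptimalAssignment {N : ℕ} {R : Matrix (Fin N) (Fin N) ℝ}
    (h : ∀ σ π : Equiv.Perm (Fin N), σ ≠ π → ∑ i, R i (σ i) ≠ ∑ i, R i (π i)) :
    ∃! P, IsOptimalAssignment R P := by
  obtain ⟨σ, hσ⟩ := Finite.exists_max fun σ : Equiv.Perm (Fin N) => ∑ i, R i (σ i)
  refine ⟨σ.permMatrix ℝ, ⟨⟨σ, rfl⟩, fun π => ?_⟩, ?_⟩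
  · simpa only [assignmentReward_permMatrix] using hσ π
  · rintro _ ⟨⟨π, rfl⟩, hπ⟩
    by_contra hne
    have h1 := hπ σ
    simp only [assignmentReward_permMatrix] at h1
    exact h π σ (fun h => hne (by rw [h])) (le_antisymm (hσ π) h1)

theorem ae_existsUnique_isOptimalAssignment {N : ℕ} (X : Matrix (Fin N) (Fin N) ℝ)
    {Ω : Type*} [MeasurableSpace Ω] (μ : Measure Ω) [IsProbabilityMeasure μ]
    (ε : Fin N → Fin N → Ω → ℝ) (hε : ∀ i j, IsStandardGumbel (ε i j) μ)
    (hindep : iIndepFun (fun p : Fin N × Fin N => ε p.1 p.2) μ) :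
    ∀ᵐ ω ∂μ, ∃! P, IsOptimalAssignment (X + Matrix.of fun i j => ε i j ω) P := by
  have key : ∀ σ π : Equiv.Perm (Fin N), σ ≠ π → ∀ᵐ ω ∂μ,
      ∑ i, (X + Matrix.of fun i j => ε i j ω) i (σ i) ≠
        ∑ i, (X + Matrix.of fun i j => ε i j ω) i (π i) := by
    intro σ π hne
    obtain ⟨i, hi⟩ : ∃ i, σ i ≠ π i := by
      by_contra! hcon
      exact hne (Equiv.ext hcon)
    have h0 := hindep.measure_weighted_sum_eq_zero (fun p => (hε p.1 p.2).aemeasurable)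
      (fun p => (hε p.1 p.2).measure_eq_zero)
      (w := fun p => σ.permMatrix ℝ p.1 p.2 - π.permMatrix ℝ p.1 p.2) (i := (i, σ i))
      (by simp [hi.symm]) (∑ i, X i (π i) - ∑ i, X i (σ i))
    rw [ae_iff, ← h0]
    congr 1
    ext ω
    simp only [Fintype.sum_prod_type, sub_mul, Finset.sum_sub_distrib, permMatrix_apply', ite_mul,
      one_mul, zero_mul, Finset.sum_ite_eq, Finset.mem_univ, if_true, Matrix.add_apply,
      Matrix.of_apply, Finset.sum_add_distrib, not_not, ne_eq, Set.mem_ofPred_eq]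
    constructor <;> intro h <;> linarith
  have hall : ∀ᵐ ω ∂μ, ∀ σ π : Equiv.Perm (Fin N), σ ≠ π →
      ∑ i, (X + Matrix.of fun i j => ε i j ω) i (σ i) ≠
        ∑ i, (X + Matrix.of fun i j => ε i j ω) i (π i) := by
    rw [ae_all_iff]; intro σ
    rw [ae_all_iff]; intro π
    by_cases h : σ = π
    · simp [h]
    · filter_upwards [key σ π h] with ω hω _ using hω
  filter_upwards [hall] with ω hω using existsUnique_isOptimalAssignment hω

/-! ### Normalization of positive matrices -/

section Normalization

variable {N : ℕ} {A : Matrix (Fin N) (Fin N) ℝ} {m M δ c : ℝ}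

lemma sum_mul_mem_Icc {ι : Type*} [Fintype ι] {w x : ι → ℝ} (hw : ∀ i, 0 ≤ w i)
    (h1 : ∑ i, w i = 1) (hx : ∀ i, x i ∈ Set.Icc m M) : ∑ i, w i * x i ∈ Set.Icc m M := by
  constructor
  · calc m = ∑ i, w i * m := by rw [← Finset.sum_mul, h1, one_mul]
      _ ≤ _ := Finset.sum_le_sum fun i _ => mul_le_mul_of_nonneg_left (hx i).1 (hw i)
  · calc _ ≤ ∑ i, w i * M :=
          Finset.sum_le_sum fun i _ => mul_le_mul_of_nonneg_left (hx i).2 (hw i)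
      _ = M := by rw [← Finset.sum_mul, h1, one_mul]

lemma inv_mem_Icc_inv {x : ℝ} (hm : 0 < m) (hx : x ∈ Set.Icc m M) : x⁻¹ ∈ Set.Icc M⁻¹ m⁻¹ :=
  ⟨inv_anti₀ (hm.trans_le hx.1) hx.2, inv_anti₀ hm hx.1⟩

lemma rowSum_pos (hA : ∀ i j, 0 < A i j) (i : Fin N) : 0 < ∑ l, A i l :=
  Finset.sum_pos (fun l _ => hA i l) ⟨i, Finset.mem_univ i⟩

lemma colNormalize_eq_transpose (A : Matrix (Fin N) (Fin N) ℝ) :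
    colNormalize A = (rowNormalize A.transpose).transpose := rfl

lemma rowNormalize_pos (hA : ∀ i j, 0 < A i j) (i j : Fin N) : 0 < rowNormalize A i j :=
  div_pos (hA i j) (rowSum_pos hA i)

lemma colNormalize_pos (hA : ∀ i j, 0 < A i j) (i j : Fin N) : 0 < colNormalize A i j :=
  rowNormalize_pos (A := A.transpose) (fun i j => hA j i) j i

lemma rowSum_rowNormalize (hA : ∀ i j, 0 < A i j) (i : Fin N) :
    ∑ l, rowNormalize A i l = 1 := by
  simp only [rowNormalize, Matrix.of_apply]
  rw [← Finset.sum_div, div_self (rowSum_pos hA i).ne']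

lemma colSum_colNormalize (hA : ∀ i j, 0 < A i j) (j : Fin N) :
    ∑ l, colNormalize A l j = 1 :=
  rowSum_rowNormalize (A := A.transpose) (fun i j => hA j i) j

lemma colSum_rowNormalize (A : Matrix (Fin N) (Fin N) ℝ) (j : Fin N) :
    ∑ i, rowNormalize A i j = ∑ i, A i j * (∑ l, A i l)⁻¹ := rfl

lemma colSum_rowNormalize_mem (hA : ∀ i j, 0 < A i j) (hc : ∀ j, ∑ i, A i j = 1) (hm : 0 < m)
    (hr : ∀ i, ∑ l, A i l ∈ Set.Icc m M) (j : Fin N) :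
    ∑ i, rowNormalize A i j ∈ Set.Icc M⁻¹ m⁻¹ :=
  sum_mul_mem_Icc (fun i => (hA i j).le) (hc j) fun i => inv_mem_Icc_inv hm (hr i)

lemma rowSum_colNormalize_mem (hA : ∀ i j, 0 < A i j) (hr : ∀ i, ∑ l, A i l = 1) (hm : 0 < m)
    (hc : ∀ j, ∑ i, A i j ∈ Set.Icc m M) (i : Fin N) :
    ∑ j, colNormalize A i j ∈ Set.Icc M⁻¹ m⁻¹ :=
  colSum_rowNormalize_mem (A := A.transpose) (fun i j => hA j i) hr hm hc i

/-- Doeblin contraction: if all entries of a column stochastic matrix are at least `c`, then row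
normalization contracts the relative spread of the marginals by the factor `1 - N * c`. -/
lemma colSum_rowNormalize_contract (hcA : ∀ i j, c ≤ A i j) (hNc : N * c ≤ 1) (hc0 : 0 < c)
    (hc : ∀ j, ∑ i, A i j = 1) (hm : 0 < m) (hδ : 0 ≤ δ) (hM : M ≤ (1 + δ) * m)
    (hr : ∀ i, ∑ l, A i l ∈ Set.Icc m M) (hmM : m ≤ M) :
    ∃ m' M', 0 < m' ∧ m' ≤ M' ∧ M' ≤ (1 + (1 - N * c) * δ) * m' ∧
      ∀ j, ∑ i, rowNormalize A i j ∈ Set.Icc m' M' := by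
  set x : Fin N → ℝ := fun i => (∑ l, A i l)⁻¹
  have hx : ∀ i, x i ∈ Set.Icc M⁻¹ m⁻¹ := fun i => inv_mem_Icc_inv hm (hr i)
  have hM0 : 0 < M := hm.trans_le hmM
  have hab : m⁻¹ ≤ (1 + δ) * M⁻¹ := by
    rw [← div_eq_mul_inv, le_div_iff₀ hM0, inv_mul_le_iff₀ hm, mul_comm]
    exact hM
  have ha : 0 < M⁻¹ := inv_pos.2 hM0
  have hle : M⁻¹ ≤ m⁻¹ := inv_anti₀ hm hmM
  have hX : N * M⁻¹ ≤ ∑ i, x i := by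
    calc N * M⁻¹ = ∑ _i : Fin N, M⁻¹ := by simp
      _ ≤ _ := Finset.sum_le_sum fun i _ => (hx i).1
  have hm' : M⁻¹ ≤ c * ∑ i, x i + (1 - N * c) * M⁻¹ := by nlinarith
  refine ⟨c * ∑ i, x i + (1 - N * c) * M⁻¹, c * ∑ i, x i + (1 - N * c) * m⁻¹,
    ha.trans_le hm', ?_, ?_, fun j => ?_⟩
  · nlinarith
  · have h1 : (1 - N * c) * m⁻¹ ≤ (1 - N * c) * ((1 + δ) * M⁻¹) :=
      mul_le_mul_of_nonneg_left hab (by linarith)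
    have h2 : (1 - N * c) * δ * M⁻¹ ≤ (1 - N * c) * δ * (c * ∑ i, x i + (1 - N * c) * M⁻¹) :=
      mul_le_mul_of_nonneg_left hm' (mul_nonneg (by linarith) hδ)
    linarith
  -- The part `c` of each entry contributes equally to all column sums; only the remaining mass `1 -
  -- N * c` sees the spread of the inverse row sums.
  · have e : ∑ i, rowNormalize A i j = c * ∑ i, x i + ∑ i, (A i j - c) * x i := by
      rw [colSum_rowNormalize, Finset.mul_sum, ← Finset.sum_add_distrib]
      exact Finset.sum_congr rfl fun i _ => by simp only [x]; ring
    have hs : ∑ i, (A i j - c) = 1 - N * c := by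
      rw [Finset.sum_sub_distrib, hc]; simp
    rw [e, ← hs, Finset.sum_mul, Finset.sum_mul]
    constructor
    · gcongr with i
      · linarith [hcA i j]
      · exact (hx i).1
    · gcongr with i
      · linarith [hcA i j]
      · exact (hx i).2

/-- A lower bound for the cross ratios of the entries. -/
def CrossRatioBound (A : Matrix (Fin N) (Fin N) ℝ) (c : ℝ) : Prop :=
  ∀ i j i' j', c * (A i j' * A i' j) ≤ A i j * A i' j'

/-- The row factors cancel in a cross ratio, so a bound for the initial matrix persists along the
iteration. -/
lemma CrossRatioBound.rowNormalize (h : CrossRatioBound A c) (hA : ∀ i j, 0 < A i j) :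
    CrossRatioBound (rowNormalize A) c := by
  intro i j i' j'
  simp only [_root_.rowNormalize, Matrix.of_apply]
  rw [div_mul_div_comm, div_mul_div_comm, ← mul_div_assoc]
  exact div_le_div_of_nonneg_right (h i j i' j')
    (mul_pos (rowSum_pos hA i) (rowSum_pos hA i')).le

lemma CrossRatioBound.colNormalize (h : CrossRatioBound A c) (hA : ∀ i j, 0 < A i j) :
    CrossRatioBound (colNormalize A) c := by
  have ht : CrossRatioBound A.transpose c := fun i j i' j' => by
    simpa only [Matrix.transpose_apply, mul_comm] using h j i j' i'
  have := ht.rowNormalize fun i j => hA j i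
  intro i j i' j'
  simpa only [colNormalize_eq_transpose, Matrix.transpose_apply, mul_comm] using this j i j' i'

/-- Row `i` has an entry of size at least `m / N` and column `j` one of size at least `1 / N`. The
entry at the opposite corner of this rectangle is at most one, so the cross ratio bounds `A i j`
from below. -/
lemma CrossRatioBound.le_apply (h : CrossRatioBound A c) (hc0 : 0 < c) (hA : ∀ i j, 0 < A i j)
    (hc : ∀ j, ∑ i, A i j = 1) (hr : ∀ i, m ≤ ∑ l, A i l) (i j : Fin N) :
    c * (m / N * (1 / N)) ≤ A i j := by
  have : Nonempty (Fin N) := ⟨i⟩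
  have hN : (0 : ℝ) < N := by exact_mod_cast Fin.pos i
  obtain ⟨j', hj'⟩ : ∃ j', m / N ≤ A i j' := by
    obtain ⟨j', -, hj'⟩ := Finset.exists_le_of_sum_le (s := Finset.univ)
      (f := fun _ : Fin N => m / N) (g := fun l => A i l) Finset.univ_nonempty
      (by simpa [mul_div_cancel₀ _ hN.ne'] using hr i)
    exact ⟨j', hj'⟩
  obtain ⟨i', hi'⟩ : ∃ i', 1 / N ≤ A i' j := by
    obtain ⟨j', -, hj'⟩ := Finset.exists_le_of_sum_le (s := Finset.univ)
      (f := fun _ : Fin N => 1 / (N : ℝ)) (g := fun l => A l j) Finset.univ_nonempty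
      (by rw [hc]; simp [hN.ne'])
    exact ⟨j', hj'⟩
  have h1 : A i' j' ≤ 1 := by
    rw [← hc j']
    exact Finset.single_le_sum (f := fun l => A l j') (fun l _ => (hA l j').le)
      (Finset.mem_univ i')
  calc c * (m / N * (1 / N)) ≤ c * (A i j' * A i' j) := by gcongr; exact (hA _ _).le
    _ ≤ A i j * A i' j' := h i j i' j'
    _ ≤ A i j * 1 := by gcongr; exact (hA i j).le
    _ = A i j := mul_one _

end Normalization

/-! ### Linear convergence of the Sinkhorn iteration -/

section Convergence

variable {N : ℕ} (X : Matrix (Fin N) (Fin N) ℝ)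

lemma sinkhornIter_succ (k : ℕ) :
    sinkhornIter X (k + 1) = colNormalize (rowNormalize (sinkhornIter X k)) := rfl

lemma sinkhornIter_pos (k : ℕ) : ∀ i j, 0 < sinkhornIter X k i j := by
  induction k with
  | zero => exact fun i j => Real.exp_pos _
  | succ k ih => exact colNormalize_pos (rowNormalize_pos ih)

lemma colSum_sinkhornIter_succ (k : ℕ) (j : Fin N) : ∑ i, sinkhornIter X (k + 1) i j = 1 :=
  colSum_colNormalize (rowNormalize_pos (sinkhornIter_pos X k)) j

lemma sinkhornIter_succ_le_one (k : ℕ) (i j : Fin N) : sinkhornIter X (k + 1) i j ≤ 1 := by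
  rw [← colSum_sinkhornIter_succ X k j]
  exact Finset.single_le_sum (f := fun l => sinkhornIter X (k + 1) l j)
    (fun l _ => (sinkhornIter_pos X _ l j).le) (Finset.mem_univ i)

lemma sum_rowSum_sinkhornIter_succ (k : ℕ) :
    ∑ i, ∑ j, sinkhornIter X (k + 1) i j = N := by
  refine Finset.sum_comm.trans ?_
  simp [colSum_sinkhornIter_succ]

variable {X} in
-- Each half-step averages the inverse marginals, so it inverts the interval; two half-steps restore
-- it.
lemma rowSum_sinkhornIter_mem_succ {k : ℕ} {m M : ℝ} (hm : 0 < m) (hmM : m ≤ M)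
    (h : ∀ i, ∑ j, sinkhornIter X (k + 1) i j ∈ Set.Icc m M) (i : Fin N) :
    ∑ j, sinkhornIter X (k + 2) i j ∈ Set.Icc m M := by
  have h1 := colSum_rowNormalize_mem (sinkhornIter_pos X _) (colSum_sinkhornIter_succ X k) hm h
  have h2 := rowSum_colNormalize_mem (rowNormalize_pos (sinkhornIter_pos X _))
    (rowSum_rowNormalize (sinkhornIter_pos X _)) (inv_pos.2 (hm.trans_le hmM)) h1 i
  rwa [inv_inv, inv_inv] at h2

variable {X} in
lemma rowSum_sinkhornIter_mem_of_le {k l : ℕ} {m M : ℝ} (hm : 0 < m) (hmM : m ≤ M)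
    (h : ∀ i, ∑ j, sinkhornIter X (k + 1) i j ∈ Set.Icc m M) (hkl : k ≤ l) :
    ∀ i, ∑ j, sinkhornIter X (l + 1) i j ∈ Set.Icc m M := by
  induction l, hkl using Nat.le_induction with
  | base => exact h
  | succ l _ ih => exact rowSum_sinkhornIter_mem_succ hm hmM ih

lemma exists_crossRatioBound : ∃ c, 0 < c ∧ ∀ k, CrossRatioBound (sinkhornIter X k) c := by
  obtain ⟨B, hB⟩ : ∃ B, ∀ i j, |X i j| ≤ B := by
    obtain ⟨B, hB⟩ := (Set.finite_range fun p : Fin N × Fin N => |X p.1 p.2|).bddAbove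
    exact ⟨B, fun i j => hB ⟨(i, j), rfl⟩⟩
  refine ⟨Real.exp (-(4 * B)), Real.exp_pos _, fun k => ?_⟩
  induction k with
  | zero =>
    intro i j i' j'
    simp only [sinkhornIter, Matrix.map_apply, ← Real.exp_add]
    rw [Real.exp_le_exp]
    have h1 := abs_le.1 (hB i j)
    have h2 := abs_le.1 (hB i' j')
    have h3 := abs_le.1 (hB i j')
    have h4 := abs_le.1 (hB i' j)
    linarith [h1.1, h2.1, h3.2, h4.2]
  | succ k ih =>
    exact (ih.rowNormalize (sinkhornIter_pos X k)).colNormalize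
      (rowNormalize_pos (sinkhornIter_pos X k))

lemma exists_rowSum_bounds (k : ℕ) :
    ∃ m M, 0 < m ∧ m ≤ M ∧ ∀ i, ∑ j, sinkhornIter X k i j ∈ Set.Icc m M := by
  rcases isEmpty_or_nonempty (Fin N) with h | h
  · exact ⟨1, 1, one_pos, le_rfl, fun i => h.elim i⟩
  · obtain ⟨i, hi⟩ := Finite.exists_min fun i => ∑ j, sinkhornIter X k i j
    obtain ⟨i', hi'⟩ := Finite.exists_max fun i => ∑ j, sinkhornIter X k i j
    exact ⟨_, _, rowSum_pos (sinkhornIter_pos X k) i, hi i', fun l => ⟨hi l, hi' l⟩⟩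

/-- The relative spread of the row sums of the Sinkhorn iterates decays geometrically. -/
lemma exists_rowSum_geometric_bounds : ∃ q C : ℝ, 0 < q ∧ q < 1 ∧ 0 ≤ C ∧ ∀ k, ∃ m M, 0 < m ∧
    m ≤ M ∧ M ≤ (1 + C * q ^ k) * m ∧ ∀ i, ∑ j, sinkhornIter X (k + 1) i j ∈ Set.Icc m M := by
  rcases Nat.eq_zero_or_pos N with rfl | hN
  · exact ⟨1 / 2, 0, by norm_num, by norm_num, le_rfl,
      fun k => ⟨1, 1, one_pos, le_rfl, by simp, fun i => i.elim0⟩⟩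
  have hN' : (0 : ℝ) < N := by exact_mod_cast hN
  obtain ⟨c, hc0, hc⟩ := exists_crossRatioBound X
  obtain ⟨m₀, M₀, hm₀, hmM₀, hr₀⟩ := exists_rowSum_bounds X 1
  set e := c * (m₀ / N * (1 / N)) with he
  have he0 : 0 < e := by positivity
  have hle : ∀ k i j, e ≤ sinkhornIter X (k + 1) i j := fun k =>
    (hc (k + 1)).le_apply hc0 (sinkhornIter_pos X _) (colSum_sinkhornIter_succ X k)
      fun i => (rowSum_sinkhornIter_mem_of_le hm₀ hmM₀ hr₀ (Nat.zero_le k) i).1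
  have hNe : N * e ≤ 1 := by
    rw [← colSum_sinkhornIter_succ X 0 ⟨0, hN⟩]
    calc N * e = ∑ _i : Fin N, e := by simp
      _ ≤ _ := Finset.sum_le_sum fun i _ => hle 0 i _
  -- The contraction factor `1 - N * e` may vanish, whereas a rate has to be positive.
  set q := max (1 - N * e) (1 / 2)
  refine ⟨q, M₀ / m₀ - 1, lt_max_of_lt_right (by norm_num),
    max_lt (by nlinarith) (by norm_num), by rw [sub_nonneg, one_le_div hm₀]; exact hmM₀,
    fun k => ?_⟩
  have hC : 0 ≤ M₀ / m₀ - 1 := by rw [sub_nonneg, one_le_div hm₀]; exact hmM₀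
  have hq0 : 0 < q := lt_max_of_lt_right (by norm_num)
  induction k with
  | zero => exact ⟨m₀, M₀, hm₀, hmM₀, by simp [hm₀.ne'], hr₀⟩
  | succ k ih =>
    obtain ⟨m, M, hm, hmM, hM, hr⟩ := ih
    obtain ⟨m', M', hm', hmM', hM', hr'⟩ := colSum_rowNormalize_contract (hle k) hNe he0
      (colSum_sinkhornIter_succ X k) hm (by positivity) hM hr hmM
    have hM0 := hm'.trans_le hmM'
    refine ⟨M'⁻¹, m'⁻¹, inv_pos.2 hM0, inv_anti₀ hm' hmM', ?_,
      rowSum_colNormalize_mem (rowNormalize_pos (sinkhornIter_pos X _))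
        (rowSum_rowNormalize (sinkhornIter_pos X _)) hm' hr'⟩
    rw [← div_eq_mul_inv, le_div_iff₀ hM0, inv_mul_le_iff₀ hm', mul_comm m']
    refine hM'.trans (mul_le_mul_of_nonneg_right ?_ hm'.le)
    have : (1 - N * e) * ((M₀ / m₀ - 1) * q ^ k) ≤ q * ((M₀ / m₀ - 1) * q ^ k) :=
      mul_le_mul_of_nonneg_right (le_max_left _ _) (by positivity)
    rw [pow_succ]
    linarith

/-- The row sums have mean one, so `m ≤ 1 ≤ M`, and the relative spread controls the error. -/
lemma abs_rowSum_sub_one_le {k : ℕ} {m M δ : ℝ} (hδ : 0 ≤ δ)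
    (hM : M ≤ (1 + δ) * m) (h : ∀ i, ∑ j, sinkhornIter X (k + 1) i j ∈ Set.Icc m M)
    (i : Fin N) : |∑ j, sinkhornIter X (k + 1) i j - 1| ≤ δ := by
  have hN : (0 : ℝ) < N := by exact_mod_cast Fin.pos i
  have hs := sum_rowSum_sinkhornIter_succ X k
  have h1 : N * m ≤ N := by
    calc N * m = ∑ _i : Fin N, m := by simp
      _ ≤ ∑ i, ∑ j, sinkhornIter X (k + 1) i j := Finset.sum_le_sum fun i _ => (h i).1
      _ = N := hs
  have h2 : N ≤ N * M := by
    calc (N : ℝ) = ∑ i, ∑ j, sinkhornIter X (k + 1) i j := hs.symm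
      _ ≤ ∑ _i : Fin N, M := Finset.sum_le_sum fun i _ => (h i).2
      _ = N * M := by simp
  have h3 : m ≤ 1 := by nlinarith
  have h4 : 1 ≤ M := by nlinarith
  rw [abs_le]
  constructor <;> nlinarith [(h i).1, (h i).2]

/-- One step multiplies an entry, which is at most one, by a factor between `m / M` and `M / m`. -/
lemma abs_sinkhornIter_succ_sub_le {k : ℕ} {m M δ : ℝ} (hδ : 0 ≤ δ) (hm : 0 < m) (hmM : m ≤ M)
    (hM : M ≤ (1 + δ) * m) (h : ∀ i, ∑ j, sinkhornIter X (k + 1) i j ∈ Set.Icc m M)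
    (i j : Fin N) : |sinkhornIter X (k + 2) i j - sinkhornIter X (k + 1) i j| ≤ δ := by
  set S := sinkhornIter X (k + 1)
  have hc := colSum_rowNormalize_mem (sinkhornIter_pos X _) (colSum_sinkhornIter_succ X k) hm h j
  have hM0 : 0 < M := hm.trans_le hmM
  set ρ := ∑ l, S i l
  set γ := ∑ l, rowNormalize S l j
  have hγ := inv_mem_Icc_inv (inv_pos.2 hM0) hc
  have hρ := inv_mem_Icc_inv hm (h i)
  rw [inv_inv, inv_inv] at hγ
  have e : sinkhornIter X (k + 2) i j = S i j * (ρ⁻¹ * γ⁻¹) := by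
    rw [← mul_assoc]; rfl
  have hS0 : 0 < S i j := sinkhornIter_pos X _ i j
  have hS1 : S i j ≤ 1 := sinkhornIter_succ_le_one X k i j
  have u : ρ⁻¹ * γ⁻¹ ≤ 1 + δ := by
    calc ρ⁻¹ * γ⁻¹ ≤ m⁻¹ * M := mul_le_mul hρ.2 hγ.2 (hm.le.trans hγ.1) (inv_pos.2 hm).le
      _ ≤ 1 + δ := by rw [inv_mul_le_iff₀ hm, mul_comm]; exact hM
  have l : 1 - δ ≤ ρ⁻¹ * γ⁻¹ := by
    calc 1 - δ ≤ M⁻¹ * m := by rw [le_inv_mul_iff₀ hM0]; nlinarith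
      _ ≤ ρ⁻¹ * γ⁻¹ := mul_le_mul hρ.1 hγ.1 hm.le ((inv_pos.2 hM0).le.trans hρ.1)
  rw [e, abs_le]
  constructor <;> nlinarith

theorem exists_isSinkhornLimit_of_geometric : ∃ (L : Matrix (Fin N) (Fin N) ℝ) (q C : ℝ),
    0 < q ∧ q < 1 ∧ IsSinkhornLimit X L ∧
      ∀ k i j, |sinkhornIter X (k + 1) i j - L i j| ≤ C * q ^ k := by
  obtain ⟨q, C, hq0, hq1, hC, h⟩ := exists_rowSum_geometric_bounds X
  have hd : ∀ i j k, dist (sinkhornIter X (k + 1) i j) (sinkhornIter X (k + 1 + 1) i j) ≤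
      C * q ^ k := by
    intro i j k
    obtain ⟨m, M, hm, hmM, hM, hr⟩ := h k
    rw [dist_comm, Real.dist_eq]
    exact abs_sinkhornIter_succ_sub_le X (by positivity) hm hmM hM hr i j
  have hL : ∀ i j, ∃ l, Tendsto (fun k => sinkhornIter X (k + 1) i j) atTop (𝓝 l) :=
    fun i j => cauchySeq_tendsto_of_complete (cauchySeq_of_le_geometric q C hq1 (hd i j))
  choose L hL using hL
  refine ⟨L, q, C / (1 - q), hq0, hq1,
    fun i j => (tendsto_add_atTop_iff_nat 1).1 (hL i j), fun k i j => ?_⟩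
  rw [← Real.dist_eq, div_mul_eq_mul_div]
  exact dist_le_of_le_geometric_of_tendsto q C hq1 (hd i j) (hL i j) k

lemma frobenius_norm_sq (A : Matrix (Fin N) (Fin N) ℝ) : ‖A‖ ^ 2 = ∑ i, ∑ j, A i j ^ 2 := by
  rw [Matrix.frobenius_norm_def, ← Real.sqrt_eq_rpow, Real.sq_sqrt (by positivity)]
  simp

lemma frobenius_norm_le {A : Matrix (Fin N) (Fin N) ℝ} {e : ℝ} (he : 0 ≤ e)
    (h : ∀ i j, |A i j| ≤ e) : ‖A‖ ≤ N * e := by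
  refine le_of_sq_le_sq ?_ (by positivity)
  rw [frobenius_norm_sq]
  calc ∑ i, ∑ j, A i j ^ 2 ≤ ∑ _i : Fin N, ∑ _j : Fin N, e ^ 2 :=
        Finset.sum_le_sum fun i _ => Finset.sum_le_sum fun j _ => sq_le_sq' (abs_le.1 (h i j)).1
          (abs_le.1 (h i j)).2
    _ = (N * e) ^ 2 := by simp; ring

lemma abs_apply_le_frobenius_norm (A : Matrix (Fin N) (Fin N) ℝ) (i j : Fin N) :
    |A i j| ≤ ‖A‖ := by
  refine abs_le_of_sq_le_sq ?_ (norm_nonneg _)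
  rw [frobenius_norm_sq]
  exact (Finset.single_le_sum (f := fun j => A i j ^ 2) (fun _ _ => sq_nonneg _)
    (Finset.mem_univ j)).trans (Finset.single_le_sum (f := fun i => ∑ j, A i j ^ 2)
    (fun _ _ => Finset.sum_nonneg fun _ _ => sq_nonneg _) (Finset.mem_univ i))

theorem exists_isSinkhornRate : ∃ r, IsSinkhornRate X r := by
  obtain ⟨L, q, C, hq0, hq1, hL, h⟩ := exists_isSinkhornLimit_of_geometric X
  -- The geometric bound starts at the first iterate: the division by `q` shifts the index, and the
  -- maximum covers `k = 0`.
  refine ⟨q, hq0, hq1, L, hL, max ‖sinkhornIter X 0 - L‖ (N * |C| / q), fun k => ?_⟩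
  cases k with
  | zero => simp
  | succ k =>
    calc ‖sinkhornIter X (k + 1) - L‖ ≤ N * (|C| * q ^ k) :=
          frobenius_norm_le (by positivity) fun i j => (h k i j).trans (by gcongr; exact le_abs_self C)
      _ = N * |C| / q * q ^ (k + 1) := by rw [pow_succ]; field_simp
      _ ≤ _ := by gcongr; exact le_max_right _ _

lemma tendsto_rowSum_sinkhornIter (i : Fin N) :
    Tendsto (fun k => ∑ j, sinkhornIter X k i j) atTop (𝓝 1) := by
  obtain ⟨q, C, hq0, hq1, hC, h⟩ := exists_rowSum_geometric_bounds X
  rw [← tendsto_add_atTop_iff_nat 1, tendsto_iff_dist_tendsto_zero]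
  refine squeeze_zero (fun _ => dist_nonneg) (fun k => ?_)
    (by simpa using (tendsto_pow_atTop_nhds_zero_of_lt_one hq0.le hq1).const_mul C)
  obtain ⟨m, M, hm, hmM, hM, hr⟩ := h k
  exact abs_rowSum_sub_one_le X (by positivity) hM hr i

variable {X} in
lemma IsSinkhornLimit.mem_doublyStochastic {L : Matrix (Fin N) (Fin N) ℝ}
    (hL : IsSinkhornLimit X L) : L ∈ doublyStochastic ℝ (Fin N) := by
  rw [mem_doublyStochastic_iff_sum]
  refine ⟨fun i j => ge_of_tendsto' (hL i j) fun k => (sinkhornIter_pos X k i j).le,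
    fun i => tendsto_nhds_unique (tendsto_finsetSum _ fun j _ => hL i j)
      (tendsto_rowSum_sinkhornIter X i), fun j => ?_⟩
  refine tendsto_nhds_unique (tendsto_finsetSum _ fun i _ => hL i j) ?_
  rw [← tendsto_add_atTop_iff_nat 1]
  simp only [colSum_sinkhornIter_succ]
  exact tendsto_const_nhds

end Convergence

/-! ### Products along permutations -/

section PermProducts

variable {N : ℕ}

lemma prod_rowNormalize (A : Matrix (Fin N) (Fin N) ℝ) (π : Equiv.Perm (Fin N)) :
    ∏ i, rowNormalize A i (π i) = (∏ i, A i (π i)) / ∏ i, ∑ l, A i l := by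
  simp only [rowNormalize, Matrix.of_apply, Finset.prod_div_distrib]

lemma prod_colNormalize (A : Matrix (Fin N) (Fin N) ℝ) (π : Equiv.Perm (Fin N)) :
    ∏ i, colNormalize A i (π i) = (∏ i, A i (π i)) / ∏ j, ∑ l, A l j := by
  simp only [colNormalize, Matrix.of_apply, Finset.prod_div_distrib]
  rw [Equiv.prod_comp π fun j => ∑ l, A l j]

lemma prod_sinkhornIter_succ (X : Matrix (Fin N) (Fin N) ℝ) (k : ℕ) (π : Equiv.Perm (Fin N)) :
    ∏ i, sinkhornIter X (k + 1) i (π i) = (∏ i, sinkhornIter X k i (π i)) /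
      (∏ i, ∑ j, sinkhornIter X k i j) / ∏ j, ∑ i, rowNormalize (sinkhornIter X k) i j := by
  rw [sinkhornIter_succ, prod_colNormalize, prod_rowNormalize]

/-- Normalization divides the products along all permutations by the same number, so their ratios
keep the initial value. -/
lemma prod_sinkhornIter_le {X : Matrix (Fin N) (Fin N) ℝ} {σ π : Equiv.Perm (Fin N)} {a : ℝ}
    (h : ∑ i, X i (π i) + a ≤ ∑ i, X i (σ i)) (k : ℕ) :
    ∏ i, sinkhornIter X k i (π i) ≤ Real.exp (-a) * ∏ i, sinkhornIter X k i (σ i) := by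
  induction k with
  | zero =>
    simp only [sinkhornIter, Matrix.map_apply]
    rw [← Real.exp_sum, ← Real.exp_sum, ← Real.exp_add, Real.exp_le_exp]
    linarith
  | succ k ih =>
    rw [prod_sinkhornIter_succ, prod_sinkhornIter_succ, ← mul_div_assoc, ← mul_div_assoc]
    have h1 : 0 < ∏ i, ∑ j, sinkhornIter X k i j :=
      Finset.prod_pos fun i _ => rowSum_pos (sinkhornIter_pos X k) i
    have h2 : 0 < ∏ j, ∑ i, rowNormalize (sinkhornIter X k) i j :=
      Finset.prod_pos fun j _ => rowSum_pos
        (A := (rowNormalize (sinkhornIter X k)).transpose)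
        (fun i j => rowNormalize_pos (sinkhornIter_pos X k) j i) j
    gcongr

lemma prod_sinkhornIter_succ_le_exp {X : Matrix (Fin N) (Fin N) ℝ} {σ π : Equiv.Perm (Fin N)}
    {a : ℝ} (h : ∑ i, X i (π i) + a ≤ ∑ i, X i (σ i)) (k : ℕ) :
    ∏ i, sinkhornIter X (k + 1) i (π i) ≤ Real.exp (-a) := by
  have h1 : ∏ i, sinkhornIter X (k + 1) i (σ i) ≤ 1 :=
    Finset.prod_le_one (fun i _ => (sinkhornIter_pos X _ _ _).le)
      fun i _ => sinkhornIter_succ_le_one X k _ _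
  have h2 := prod_sinkhornIter_le h (k + 1)
  nlinarith [Real.exp_pos (-a)]

/-- A doubly stochastic matrix whose products along all permutations other than `σ` are small is
close to the permutation matrix of `σ`. -/
lemma one_sub_le_of_mem_doublyStochastic {D : Matrix (Fin N) (Fin N) ℝ}
    (hD : D ∈ doublyStochastic ℝ (Fin N)) {σ : Equiv.Perm (Fin N)} {t : ℝ} (ht : 0 ≤ t)
    (h : ∀ π, π ≠ σ → ∏ i, D i (π i) ≤ t ^ N) (i : Fin N) :
    1 - N.factorial * t ≤ D i (σ i) := by
  have hN : N ≠ 0 := (Fin.pos i).ne'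
  -- Birkhoff decomposition. The weight of `π` is at most every entry of `D` along `π`, so its
  -- `N`-th power is at most the product of these entries.
  obtain ⟨w, hw0, hw1, hwD⟩ := exists_eq_sum_perm_of_mem_doublyStochastic hD
  have hwle : ∀ π i, w π ≤ D i (π i) := by
    intro π i
    rw [← hwD, Matrix.sum_apply]
    calc w π = (w π • π.permMatrix ℝ) i (π i) := by simp
      _ ≤ _ := Finset.single_le_sum (f := fun π' => (w π' • π'.permMatrix ℝ) i (π i))
          (fun π' _ => by
            rw [Matrix.smul_apply, permMatrix_apply', smul_eq_mul]
            have := hw0 π'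
            split_ifs <;> simp [this]) (Finset.mem_univ π)
  have hwt : ∀ π, π ≠ σ → w π ≤ t := by
    intro π hπ
    refine le_of_pow_le_pow_left₀ hN ht ?_
    calc w π ^ N = ∏ _i : Fin N, w π := by simp
      _ ≤ ∏ i, D i (π i) := Finset.prod_le_prod (fun _ _ => hw0 π) fun i _ => hwle π i
      _ ≤ t ^ N := h π hπ
  have hsum : ∑ π ∈ Finset.univ.erase σ, w π ≤ N.factorial * t := by
    calc ∑ π ∈ Finset.univ.erase σ, w π ≤ ∑ _π ∈ Finset.univ.erase σ, t :=
          Finset.sum_le_sum fun π hπ => hwt π (Finset.ne_of_mem_erase hπ)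
      _ ≤ ∑ _π : Equiv.Perm (Fin N), t :=
          Finset.sum_le_sum_of_subset_of_nonneg (Finset.erase_subset _ _) fun _ _ _ => ht
      _ = N.factorial * t := by simp [Fintype.card_perm]
  have := Finset.add_sum_erase Finset.univ w (Finset.mem_univ σ)
  linarith [hwle σ i]

lemma eq_permMatrix_of_mem_doublyStochastic {D : Matrix (Fin N) (Fin N) ℝ}
    (hD : D ∈ doublyStochastic ℝ (Fin N)) {σ : Equiv.Perm (Fin N)}
    (h : ∀ π, π ≠ σ → ∏ i, D i (π i) = 0) (i j : Fin N) : σ.permMatrix ℝ i j = D i j := by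
  have hN : N ≠ 0 := (Fin.pos i).ne'
  have h1 := one_sub_le_of_mem_doublyStochastic hD le_rfl
    (fun π hπ => by rw [h π hπ, zero_pow hN]) i
  rw [mul_zero, sub_zero] at h1
  rw [mem_doublyStochastic_iff_sum] at hD
  have h2 := Finset.add_sum_erase Finset.univ (D i) (Finset.mem_univ (σ i))
  have hpos : ∀ l ∈ Finset.univ.erase (σ i), 0 ≤ D i l := fun l _ => hD.1 i l
  have h3 := Finset.sum_nonneg hpos
  rw [hD.2.1 i] at h2
  rw [permMatrix_apply']
  split_ifs with hij
  · subst hij; linarith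
  · have h4 := (Finset.sum_eq_zero_iff_of_nonneg hpos).1 (by linarith) j
      (Finset.mem_erase.2 ⟨fun h => hij h.symm, Finset.mem_univ j⟩)
    exact h4.symm

/-- An approximately doubly stochastic matrix whose products along all permutations other than `σ`
are small is close to the permutation matrix of `σ`. -/
lemma exists_sum_sq_sub_le_of_approx (σ : Equiv.Perm (Fin N)) {e : ℝ} (he : 0 < e) :
    ∃ δ > 0, ∀ S : Fin N → Fin N → ℝ, (∀ i j, 0 ≤ S i j) → (∀ i j, S i j ≤ 1) →
      (∀ j, ∑ i, S i j = 1) → (∀ i, |∑ j, S i j - 1| ≤ δ) →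
      (∀ π : Equiv.Perm (Fin N), π ≠ σ → ∏ i, S i (π i) ≤ δ) →
      ∑ i, ∑ j, (σ.permMatrix ℝ i j - S i j) ^ 2 ≤ e := by
  -- Compactness: on column stochastic matrices `F` vanishes only at the matrix of `σ`, so it has a
  -- positive minimum where the squared distance `G` is at least `e`.
  let F : (Fin N → Fin N → ℝ) → ℝ := fun S => ∑ i, |∑ j, S i j - 1| +
    ∑ π ∈ Finset.univ.erase σ, ∏ i, S i (π i)
  let G : (Fin N → Fin N → ℝ) → ℝ := fun S => ∑ i, ∑ j, (σ.permMatrix ℝ i j - S i j) ^ 2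
  have hF : Continuous F := by fun_prop
  have hG : Continuous G := by fun_prop
  let K : Set (Fin N → Fin N → ℝ) := (Set.univ.pi fun _ => Set.univ.pi fun _ => Set.Icc 0 1) ∩
    ({S | ∀ j, ∑ i, S i j = 1} ∩ {S | e ≤ G S})
  have hK : IsCompact K := by
    refine (isCompact_univ_pi fun _ => isCompact_univ_pi fun _ => isCompact_Icc).inter_right
      (IsClosed.inter ?_ (isClosed_le continuous_const hG))
    have : {S : Fin N → Fin N → ℝ | ∀ j, ∑ i, S i j = 1} =
        ⋂ j, {S : Fin N → Fin N → ℝ | ∑ i, S i j = 1} := by ext; simp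
    rw [this]
    exact isClosed_iInter fun j => isClosed_eq (by fun_prop) continuous_const
  rcases K.eq_empty_or_nonempty with hemp | hne
  · refine ⟨1, one_pos, fun S h0 h1 hc _ _ => ?_⟩
    by_contra! hcon
    have : S ∈ K := ⟨fun i _ j _ => ⟨h0 i j, h1 i j⟩, hc, hcon.le⟩
    rw [hemp] at this
    exact this
  obtain ⟨S₀, ⟨hS01, hSc, hSe⟩, hmin⟩ := hK.exists_isMinOn hne hF.continuousOn
  have hS0 : ∀ i j, 0 ≤ S₀ i j := fun i j => (hS01 i trivial j trivial).1
  have hprod : ∀ π ∈ Finset.univ.erase σ, 0 ≤ ∏ i, S₀ i (π i) :=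
    fun π _ => Finset.prod_nonneg fun i _ => hS0 i _
  have hrow : ∀ i ∈ Finset.univ, 0 ≤ |∑ j, S₀ i j - 1| := fun i _ => abs_nonneg _
  have hFpos : 0 < F S₀ := by
    have h1 := Finset.sum_nonneg hrow
    have h2 := Finset.sum_nonneg hprod
    refine lt_of_le_of_ne (add_nonneg h1 h2) fun hzero => ?_
    have hz : ∑ i, |∑ j, S₀ i j - 1| + ∑ π ∈ Finset.univ.erase σ, ∏ i, S₀ i (π i) = 0 := hzero.symm
    have h3 := (Finset.sum_eq_zero_iff_of_nonneg hrow).1 (by linarith)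
    have h4 := (Finset.sum_eq_zero_iff_of_nonneg hprod).1 (by linarith)
    have hds : Matrix.of S₀ ∈ doublyStochastic ℝ (Fin N) := by
      rw [mem_doublyStochastic_iff_sum]
      exact ⟨hS0, fun i => by
        simpa [sub_eq_zero] using h3 i (Finset.mem_univ i), hSc⟩
    have h5 := eq_permMatrix_of_mem_doublyStochastic hds (σ := σ)
      fun π hπ => h4 π (Finset.mem_erase.2 ⟨hπ, Finset.mem_univ π⟩)
    have h6 : G S₀ = 0 := Finset.sum_eq_zero fun i _ => Finset.sum_eq_zero fun j _ => by
      rw [h5 i j]; simp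
    have h7 : e ≤ G S₀ := hSe
    linarith
  -- `F` has `N` row terms and at most `N!` product terms; the extra one makes the contradiction
  -- strict.
  set c : ℝ := N + N.factorial + 1
  have hc0 : 0 < c := by positivity
  refine ⟨F S₀ / c, by positivity, fun S h0 h1 hc hr hp => ?_⟩
  by_contra! hcon
  have hSK : S ∈ K := ⟨fun i _ j _ => ⟨h0 i j, h1 i j⟩, hc, hcon.le⟩
  have h2 : F S₀ ≤ F S := hmin hSK
  have hd : 0 < F S₀ / c := by positivity
  have h3 : ∑ i, |∑ j, S i j - 1| ≤ N * (F S₀ / c) := by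
    calc _ ≤ ∑ _i : Fin N, F S₀ / c := Finset.sum_le_sum fun i _ => hr i
      _ = _ := by simp
  have h4 : ∑ π ∈ Finset.univ.erase σ, ∏ i, S i (π i) ≤ N.factorial * (F S₀ / c) := by
    calc _ ≤ ∑ _π ∈ Finset.univ.erase σ, F S₀ / c :=
          Finset.sum_le_sum fun π hπ => hp π (Finset.ne_of_mem_erase hπ)
      _ ≤ ∑ _π : Equiv.Perm (Fin N), F S₀ / c :=
          Finset.sum_le_sum_of_subset_of_nonneg (Finset.erase_subset _ _) fun _ _ _ => hd.le
      _ = _ := by simp [Fintype.card_perm]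
  have h5 : c * (F S₀ / c) = F S₀ := mul_div_cancel₀ _ hc0.ne'
  have h6 : F S = ∑ i, |∑ j, S i j - 1| + ∑ π ∈ Finset.univ.erase σ, ∏ i, S i (π i) := rfl
  have h7 : c * (F S₀ / c) = N * (F S₀ / c) + N.factorial * (F S₀ / c) + F S₀ / c := by
    simp only [c]; ring
  linarith

/-- All permutation matrices have the same norm, so maximizing the reward is minimizing the distance
to `S`. -/
lemma norm_permMatrix_sub_sq (S : Matrix (Fin N) (Fin N) ℝ) (σ : Equiv.Perm (Fin N)) :
    ‖σ.permMatrix ℝ - S‖ ^ 2 =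
      N + ∑ i, ∑ j, S i j ^ 2 - 2 * assignmentReward S (σ.permMatrix ℝ) := by
  have h1 : ∀ i j, (σ.permMatrix ℝ - S) i j ^ 2 =
      σ.permMatrix ℝ i j + S i j ^ 2 - 2 * (S i j * σ.permMatrix ℝ i j) := by
    intro i j
    rw [Matrix.sub_apply, permMatrix_apply']
    split_ifs <;> ring
  have h2 : ∑ i, ∑ j, σ.permMatrix ℝ i j = N := by simp
  rw [frobenius_norm_sq, assignmentReward]
  simp only [h1, Finset.sum_add_distrib, Finset.sum_sub_distrib, h2, ← Finset.mul_sum]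

lemma IsOptimalAssignment.norm_sub_sq_le {S P : Matrix (Fin N) (Fin N) ℝ}
    (hP : IsOptimalAssignment S P) (σ : Equiv.Perm (Fin N)) :
    ‖P - S‖ ^ 2 ≤ ‖σ.permMatrix ℝ - S‖ ^ 2 := by
  obtain ⟨⟨π, rfl⟩, h⟩ := hP
  rw [norm_permMatrix_sub_sq, norm_permMatrix_sub_sq]
  linarith [h σ]

lemma norm_permMatrix_sub_sinkhornIter_le (X : Matrix (Fin N) (Fin N) ℝ) (k : ℕ)
    (σ : Equiv.Perm (Fin N)) : ‖σ.permMatrix ℝ - sinkhornIter X (k + 1)‖ ≤ N := by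
  have h := frobenius_norm_le (A := σ.permMatrix ℝ - sinkhornIter X (k + 1)) zero_le_one ?_
  · simpa using h
  intro i j
  have h0 := sinkhornIter_pos X (k + 1) i j
  have h1 := sinkhornIter_succ_le_one X k i j
  rw [Matrix.sub_apply, permMatrix_apply', abs_le]
  split_ifs <;> constructor <;> linarith

lemma exists_gap {Y : Matrix (Fin N) (Fin N) ℝ} (h : ∃! P, IsOptimalAssignment Y P) :
    ∃ σ : Equiv.Perm (Fin N), ∃ g > 0, ∀ π, π ≠ σ → ∑ i, Y i (π i) + g ≤ ∑ i, Y i (σ i) := by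
  obtain ⟨_, ⟨⟨σ, rfl⟩, hσ⟩, huniq⟩ := h
  have hlt : ∀ π, π ≠ σ → ∑ i, Y i (π i) < ∑ i, Y i (σ i) := by
    intro π hπ
    rw [← assignmentReward_permMatrix, ← assignmentReward_permMatrix]
    refine lt_of_le_of_ne (hσ π) fun heq => hπ (permMatrix_injective (huniq _ ⟨⟨π, rfl⟩, ?_⟩))
    rw [heq]
    exact hσ
  refine ⟨σ, ?_⟩
  rcases (Finset.univ.erase σ).eq_empty_or_nonempty with he | hne
  · refine ⟨1, one_pos, fun π hπ => ?_⟩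
    have : π ∈ Finset.univ.erase σ := Finset.mem_erase.2 ⟨hπ, Finset.mem_univ π⟩
    rw [he] at this
    exact absurd this (Finset.notMem_empty π)
  · obtain ⟨π₀, hπ₀, hmin⟩ := Finset.exists_max_image _
      (fun π : Equiv.Perm (Fin N) => ∑ i, Y i (π i)) hne
    refine ⟨∑ i, Y i (σ i) - ∑ i, Y i (π₀ i), sub_pos.2 (hlt _ (Finset.ne_of_mem_erase hπ₀)),
      fun π hπ => ?_⟩
    linarith [hmin π (Finset.mem_erase.2 ⟨hπ, Finset.mem_univ π⟩)]

end PermProducts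

/-! ### A lower bound for the rate of convergence -/

section RateLowerBound

variable {N : ℕ}

/-- The oscillation of a finite family of real numbers. -/
noncomputable def osc (x : Fin N → ℝ) : ℝ := ⨆ p : Fin N × Fin N, (x p.1 - x p.2)

lemma sub_le_osc (x : Fin N → ℝ) (i j : Fin N) : x i - x j ≤ osc x :=
  le_ciSup (f := fun p : Fin N × Fin N => x p.1 - x p.2) (Set.finite_range _).bddAbove (i, j)

lemma exists_osc_eq [Nonempty (Fin N)] (x : Fin N → ℝ) :
    ∃ i j, osc x = x i - x j ∧ ∀ l, x j ≤ x l ∧ x l ≤ x i := by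
  obtain ⟨⟨i, j⟩, h⟩ := exists_eq_ciSup_of_finite (f := fun p : Fin N × Fin N => x p.1 - x p.2)
  refine ⟨i, j, h.symm, fun l => ?_⟩
  have h1 := sub_le_osc x l j
  have h2 := sub_le_osc x i l
  have h3 : x i - x j = osc x := h
  constructor <;> linarith

/-- The average with index `σ i` puts all but mass `η` on `x i`; hence the maximum and the minimum
each move inwards by at most `η * osc x`. -/
lemma osc_average_ge [Nonempty (Fin N)] {W : Fin N → Fin N → ℝ} {x : Fin N → ℝ} {η : ℝ}
    (hW : ∀ j i, 0 ≤ W j i) (h1 : ∀ j, ∑ i, W j i = 1) (σ : Equiv.Perm (Fin N))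
    (hη : ∀ i, 1 - η ≤ W (σ i) i) :
    (1 - 2 * η) * osc x ≤ osc fun j => ∑ i, W j i * x i := by
  obtain ⟨i, j, ho, hl⟩ := exists_osc_eq x
  have up : x i - η * (x i - x j) ≤ ∑ l, W (σ i) l * x l := by
    have h2 : ∑ l, W (σ i) l * (x i - x l) ≤ ∑ l ∈ Finset.univ.erase i, W (σ i) l * (x i - x j) := by
      rw [← Finset.add_sum_erase _ _ (Finset.mem_univ i), sub_self, mul_zero, zero_add]
      exact Finset.sum_le_sum fun l _ =>
        mul_le_mul_of_nonneg_left (by linarith [(hl l).1]) (hW _ _)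
    have h3 := Finset.add_sum_erase Finset.univ (W (σ i)) (Finset.mem_univ i)
    have h4 : ∑ l, W (σ i) l * (x i - x l) = x i - ∑ l, W (σ i) l * x l := by
      simp only [mul_sub, Finset.sum_sub_distrib, ← Finset.sum_mul, h1, one_mul]
    rw [← Finset.sum_mul] at h2
    nlinarith [hη i, h1 (σ i), (hl i).1]
  have dn : ∑ l, W (σ j) l * x l ≤ x j + η * (x i - x j) := by
    have h2 : ∑ l, W (σ j) l * (x l - x j) ≤ ∑ l ∈ Finset.univ.erase j, W (σ j) l * (x i - x j) := by
      rw [← Finset.add_sum_erase _ _ (Finset.mem_univ j), sub_self, mul_zero, zero_add]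
      exact Finset.sum_le_sum fun l _ =>
        mul_le_mul_of_nonneg_left (by linarith [(hl l).2]) (hW _ _)
    have h3 := Finset.add_sum_erase Finset.univ (W (σ j)) (Finset.mem_univ j)
    have h4 : ∑ l, W (σ j) l * (x l - x j) = ∑ l, W (σ j) l * x l - x j := by
      simp only [mul_sub, Finset.sum_sub_distrib, ← Finset.sum_mul, h1, one_mul]
    rw [← Finset.sum_mul] at h2
    nlinarith [hη j, h1 (σ j), (hl i).1]
  have := sub_le_osc (fun j => ∑ i, W j i * x i) (σ i) (σ j)
  rw [ho]
  linarith

lemma osc_inv_ge [Nonempty (Fin N)] {x : Fin N → ℝ} {B : ℝ} (hx : ∀ i, 0 < x i)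
    (hB : ∀ i, x i ≤ B) : osc x / B ^ 2 ≤ osc fun i => (x i)⁻¹ := by
  obtain ⟨i, j, ho, hl⟩ := exists_osc_eq x
  refine le_trans ?_ (sub_le_osc (fun i => (x i)⁻¹) j i)
  rw [ho, inv_sub_inv (hx j).ne' (hx i).ne', sq]
  exact div_le_div_of_nonneg_left (sub_nonneg.2 (hl i).1) (mul_pos (hx j) (hx i))
    (mul_le_mul (hB j) (hB i) (hx i).le ((hx j).le.trans (hB j)))

lemma osc_colSum_rowNormalize_ge [Nonempty (Fin N)] {A : Matrix (Fin N) (Fin N) ℝ} {η B : ℝ}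
    (hA : ∀ i j, 0 < A i j) (hc : ∀ j, ∑ i, A i j = 1) (σ : Equiv.Perm (Fin N))
    (hη : ∀ i, 1 - η ≤ A i (σ i)) (hη2 : 2 * η ≤ 1) (hB : ∀ i, ∑ j, A i j ≤ B) :
    (1 - 2 * η) / B ^ 2 * osc (fun i => ∑ j, A i j) ≤ osc fun j => ∑ i, rowNormalize A i j := by
  calc (1 - 2 * η) / B ^ 2 * osc (fun i => ∑ j, A i j)
      = (1 - 2 * η) * (osc (fun i => ∑ j, A i j) / B ^ 2) := by ring
    _ ≤ (1 - 2 * η) * osc (fun i => (∑ j, A i j)⁻¹) :=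
        mul_le_mul_of_nonneg_left (osc_inv_ge (rowSum_pos hA) hB) (by linarith)
    _ ≤ _ := osc_average_ge (W := fun j i => A i j) (fun j i => (hA i j).le) hc σ hη

lemma osc_rowSum_sinkhornIter_ge [Nonempty (Fin N)] {X : Matrix (Fin N) (Fin N) ℝ} {k : ℕ}
    {η : ℝ} (σ : Equiv.Perm (Fin N)) (hη0 : 0 < η) (hη2 : 4 * η ≤ 1)
    (hS : ∀ i, 1 - η ≤ sinkhornIter X (k + 1) i (σ i))
    (hR : ∀ i, 1 - η ≤ rowNormalize (sinkhornIter X (k + 1)) i (σ i))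
    (hr : ∀ i, ∑ j, sinkhornIter X (k + 1) i j ∈ Set.Icc (1 + η)⁻¹ (1 + η)) :
    (1 - 4 * η) ^ 2 * osc (fun i => ∑ j, sinkhornIter X (k + 1) i j) ≤
      osc fun i => ∑ j, sinkhornIter X (k + 2) i j := by
  have hp : 0 < (1 + η) ^ 2 := by positivity
  -- The loss of one half-step: `1 - 2 * η` from averaging, `(1 + η) ^ 2` from inverting the
  -- marginals.
  have hq : 1 - 4 * η ≤ (1 - 2 * η) / (1 + η) ^ 2 := by
    rw [le_div_iff₀ hp]
    nlinarith [pow_pos hη0 3, pow_pos hη0 2]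
  have h1 := osc_colSum_rowNormalize_ge (sinkhornIter_pos X _) (colSum_sinkhornIter_succ X k) σ hS
    (by linarith) fun i => (hr i).2
  have hc := colSum_rowNormalize_mem (sinkhornIter_pos X _) (colSum_sinkhornIter_succ X k)
    (inv_pos.2 (by linarith : 0 < 1 + η)) hr
  rw [inv_inv] at hc
  have h2 := osc_colSum_rowNormalize_ge
    (A := (rowNormalize (sinkhornIter X (k + 1))).transpose) (η := η) (B := 1 + η)
    (fun i j => rowNormalize_pos (sinkhornIter_pos X _) j i)
    (rowSum_rowNormalize (sinkhornIter_pos X _)) σ.symm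
    (fun i => by simpa using hR (σ.symm i)) (by linarith) fun j => (hc j).2
  have o1 : 0 ≤ osc fun i => ∑ j, sinkhornIter X (k + 1) i j := by
    obtain ⟨i⟩ := ‹Nonempty (Fin N)›
    simpa using sub_le_osc (fun i => ∑ j, sinkhornIter X (k + 1) i j) i i
  have hq0 : 0 ≤ 1 - 4 * η := by linarith
  have hq1 : 0 ≤ (1 - 2 * η) / (1 + η) ^ 2 := hq0.trans hq
  calc (1 - 4 * η) ^ 2 * osc (fun i => ∑ j, sinkhornIter X (k + 1) i j)
      ≤ ((1 - 2 * η) / (1 + η) ^ 2) ^ 2 * osc (fun i => ∑ j, sinkhornIter X (k + 1) i j) := by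
        gcongr
    _ = (1 - 2 * η) / (1 + η) ^ 2 *
          ((1 - 2 * η) / (1 + η) ^ 2 * osc (fun i => ∑ j, sinkhornIter X (k + 1) i j)) := by ring
    _ ≤ (1 - 2 * η) / (1 + η) ^ 2 *
          osc (fun j => ∑ i, rowNormalize (sinkhornIter X (k + 1)) i j) := by gcongr
    _ ≤ _ := h2

lemma rowNormalize_det_ne_zero_iff {A : Matrix (Fin N) (Fin N) ℝ} (hA : ∀ i j, 0 < A i j) :
    (rowNormalize A).det ≠ 0 ↔ A.det ≠ 0 := by
  have h : rowNormalize A = Matrix.of fun i j => (∑ l, A i l)⁻¹ * A i j := by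
    ext i j
    simp [rowNormalize, div_eq_inv_mul]
  rw [h, Matrix.det_mul_column]
  have : ∏ i, (∑ l, A i l)⁻¹ ≠ 0 :=
    Finset.prod_ne_zero_iff.2 fun i _ => (inv_pos.2 (rowSum_pos hA i)).ne'
  rw [mul_ne_zero_iff, and_iff_right this]

lemma sinkhornIter_succ_det_ne_zero_iff (X : Matrix (Fin N) (Fin N) ℝ) (k : ℕ) :
    (sinkhornIter X (k + 1)).det ≠ 0 ↔ (sinkhornIter X k).det ≠ 0 := by
  rw [sinkhornIter_succ, colNormalize_eq_transpose, Matrix.det_transpose,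
    rowNormalize_det_ne_zero_iff, Matrix.det_transpose,
    rowNormalize_det_ne_zero_iff (sinkhornIter_pos X k)]
  exact fun i j => rowNormalize_pos (sinkhornIter_pos X k) j i

lemma sinkhornIter_det_ne_zero {X : Matrix (Fin N) (Fin N) ℝ} {k : ℕ}
    (h : (sinkhornIter X k).det ≠ 0) (l : ℕ) : (sinkhornIter X l).det ≠ 0 := by
  have h0 : ∀ l, (sinkhornIter X l).det ≠ 0 ↔ (sinkhornIter X 0).det ≠ 0 := by
    intro l
    induction l with
    | zero => rfl
    | succ l ih => rw [sinkhornIter_succ_det_ne_zero_iff, ih]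
  rw [h0] at h ⊢
  exact h

lemma det_ne_zero_of_colStochastic_of_half_lt {A : Matrix (Fin N) (Fin N) ℝ}
    (hA : ∀ i j, 0 < A i j) (hc : ∀ j, ∑ i, A i j = 1) (σ : Equiv.Perm (Fin N))
    (h : ∀ i, 1 / 2 < A i (σ i)) : A.det ≠ 0 := by
  have hdet : (A.submatrix id σ).det ≠ 0 := by
    refine det_ne_zero_of_sum_col_lt_diag fun j => ?_
    simp only [Matrix.submatrix_apply, id, Real.norm_of_nonneg (hA _ _).le]
    have := Finset.add_sum_erase Finset.univ (fun i => A i (σ j)) (Finset.mem_univ j)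
    simp only [hc] at this
    linarith [h j]
  rw [Matrix.det_permute'] at hdet
  exact right_ne_zero_of_mul hdet

/-- The vector of inverse row sums minus one lies in the left kernel of `A`. This allows double
stochasticity to be traced backwards along the iteration. -/
lemma rowSum_eq_one_of_colSum_rowNormalize {A : Matrix (Fin N) (Fin N) ℝ} (hdet : A.det ≠ 0)
    (hc : ∀ j, ∑ i, A i j = 1) (h : ∀ j, ∑ i, rowNormalize A i j = 1) (i : Fin N) :
    ∑ j, A i j = 1 := by
  have hv : Matrix.vecMul (fun i => (∑ l, A i l)⁻¹ - 1) A = 0 := by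
    ext j
    simp only [Matrix.vecMul, dotProduct, sub_mul, one_mul, Finset.sum_sub_distrib, hc,
      Pi.zero_apply]
    rw [← h j, colSum_rowNormalize, sub_eq_zero]
    exact Finset.sum_congr rfl fun i _ => mul_comm _ _
  have := congrFun (Matrix.eq_zero_of_vecMul_eq_zero hdet hv) i
  simpa [sub_eq_zero] using this

lemma rowSum_sinkhornIter_eq_one_of_succ {X : Matrix (Fin N) (Fin N) ℝ} {k : ℕ}
    (hdet : (sinkhornIter X (k + 1)).det ≠ 0) (h : ∀ i, ∑ j, sinkhornIter X (k + 2) i j = 1)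
    (i : Fin N) : ∑ j, sinkhornIter X (k + 1) i j = 1 := by
  have hp := sinkhornIter_pos X (k + 1)
  refine rowSum_eq_one_of_colSum_rowNormalize hdet (colSum_sinkhornIter_succ X k) ?_ i
  exact rowSum_eq_one_of_colSum_rowNormalize
    (A := (rowNormalize (sinkhornIter X (k + 1))).transpose)
    (by rwa [Matrix.det_transpose, rowNormalize_det_ne_zero_iff hp])
    (rowSum_rowNormalize hp) h

lemma rowSum_sinkhornIter_eq_one {X : Matrix (Fin N) (Fin N) ℝ} {k : ℕ}
    (hdet : (sinkhornIter X 0).det ≠ 0) (h : ∀ i, ∑ j, sinkhornIter X (k + 1) i j = 1) (l : ℕ)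
    (i : Fin N) : ∑ j, sinkhornIter X (l + 1) i j = 1 := by
  have h0 : ∀ i, ∑ j, sinkhornIter X (0 + 1) i j = 1 := by
    induction k with
    | zero => exact h
    | succ k ih => exact ih (rowSum_sinkhornIter_eq_one_of_succ (sinkhornIter_det_ne_zero hdet _) h)
  have := rowSum_sinkhornIter_mem_of_le one_pos le_rfl (fun i => by rw [h0 i]; simp)
    (Nat.zero_le l) i
  exact le_antisymm this.2 this.1

lemma rowSum_sinkhornIter_eq_one_of_osc_nonpos {X : Matrix (Fin N) (Fin N) ℝ} {k : ℕ}
    (h : osc (fun i => ∑ j, sinkhornIter X (k + 1) i j) ≤ 0) (i : Fin N) :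
    ∑ j, sinkhornIter X (k + 1) i j = 1 := by
  have hN : (N : ℝ) ≠ 0 := by exact_mod_cast (Fin.pos i).ne'
  have heq : ∀ l, ∑ j, sinkhornIter X (k + 1) l j = ∑ j, sinkhornIter X (k + 1) i j := by
    intro l
    have h1 := sub_le_osc (fun i => ∑ j, sinkhornIter X (k + 1) i j) l i
    have h2 := sub_le_osc (fun i => ∑ j, sinkhornIter X (k + 1) i j) i l
    linarith
  have hs := sum_rowSum_sinkhornIter_succ X k
  simp only [heq, Finset.sum_const, Finset.card_univ, Fintype.card_fin, nsmul_eq_mul] at hs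
  exact mul_left_cancel₀ hN (by rw [hs, mul_one])

lemma le_of_eventually_mul_le {o : ℕ → ℝ} {q r C : ℝ} {K : ℕ} (hq : 0 < q) (hr : 0 < r)
    (ho : 0 < o K) (hstep : ∀ k ≥ K, q * o k ≤ o (k + 1)) (hle : ∀ k, o k ≤ C * r ^ k) :
    q ≤ r := by
  have hpow : ∀ n, q ^ n * o K ≤ o (K + n) := by
    intro n
    induction n with
    | zero => simp
    | succ n ih =>
      calc q ^ (n + 1) * o K = q * (q ^ n * o K) := by ring
        _ ≤ q * o (K + n) := by gcongr
        _ ≤ _ := hstep _ (Nat.le_add_right _ _)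
  by_contra! hlt
  have hlim : Tendsto (fun n => C * r ^ K * (r / q) ^ n) atTop (𝓝 0) := by
    simpa using (tendsto_pow_atTop_nhds_zero_of_lt_one (by positivity)
      ((div_lt_one hq).2 hlt)).const_mul (C * r ^ K)
  have : o K ≤ 0 := ge_of_tendsto' hlim fun n => by
    have h1 := (hpow n).trans (hle (K + n))
    rw [div_pow, mul_div_assoc', le_div_iff₀ (pow_pos hq n), mul_assoc, ← pow_add, mul_comm]
    exact h1
  linarith

lemma IsSinkhornLimit.one_sub_le {X L : Matrix (Fin N) (Fin N) ℝ} (hL : IsSinkhornLimit X L)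
    {σ : Equiv.Perm (Fin N)} {a : ℝ} (h : ∀ π, π ≠ σ → ∑ i, X i (π i) + a ≤ ∑ i, X i (σ i))
    (i : Fin N) : 1 - N.factorial * Real.exp (-(a / N)) ≤ L i (σ i) := by
  have hN : (N : ℝ) ≠ 0 := by exact_mod_cast (Fin.pos i).ne'
  refine one_sub_le_of_mem_doublyStochastic hL.mem_doublyStochastic (Real.exp_pos _).le
    (fun π hπ => ?_) i
  rw [← Real.exp_nat_mul, mul_neg, mul_div_cancel₀ _ hN]
  refine le_of_tendsto ((tendsto_add_atTop_iff_nat 1).2 (tendsto_finsetProd _ fun i _ => hL i (π i)))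
    (Eventually.of_forall fun k => prod_sinkhornIter_succ_le_exp (h π hπ) k)

/-- If the products along permutations other than `σ` are small, then either the Sinkhorn iterates
are doubly stochastic from the first one on, or every rate of convergence is close to one. -/
theorem IsSinkhornRate.doublyStochastic_or_le {X : Matrix (Fin N) (Fin N) ℝ} {r : ℝ}
    (hr : IsSinkhornRate X r) {σ : Equiv.Perm (Fin N)} {a η : ℝ}
    (h : ∀ π, π ≠ σ → ∑ i, X i (π i) + a ≤ ∑ i, X i (σ i))
    (hη : η = 2 * (N.factorial * Real.exp (-(a / N)))) (hη1 : η ≤ 1 / 8) :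
    (∀ k i, ∑ j, sinkhornIter X (k + 1) i j = 1) ∨ 1 - 8 * η ≤ r := by
  rcases isEmpty_or_nonempty (Fin N) with hemp | hne
  · exact Or.inl fun k i => hemp.elim i
  obtain ⟨hr0, hr1, L, hL, C, hC⟩ := hr
  have hη0 : 0 < η := by
    rw [hη]
    have := Nat.factorial_pos N
    positivity
  -- The factor 2 in `η` makes this strict, so that the iterates eventually inherit it.
  have hLη : ∀ i, 1 - η < L i (σ i) := fun i => by linarith [hL.one_sub_le h i]
  have hrow : ∀ᶠ k in atTop, ∀ i, ∑ j, sinkhornIter X k i j ∈ Set.Icc (1 + η)⁻¹ (1 + η) :=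
    eventually_all.2 fun i => tendsto_rowSum_sinkhornIter X i
      (Icc_mem_nhds (inv_lt_one_of_one_lt₀ (by linarith)) (by linarith))
  have hS : ∀ᶠ k in atTop, ∀ i, 1 - η ≤ sinkhornIter X k i (σ i) :=
    eventually_all.2 fun i => (hL i (σ i)).eventually_const_le (hLη i)
  have hR : ∀ᶠ k in atTop, ∀ i, 1 - η ≤ rowNormalize (sinkhornIter X k) i (σ i) := by
    refine eventually_all.2 fun i => ?_
    have ht := (hL i (σ i)).div (tendsto_rowSum_sinkhornIter X i) one_ne_zero
    rw [div_one] at ht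
    exact ht.eventually_const_le (hLη i)
  obtain ⟨K, hK⟩ := eventually_atTop.1 (hrow.and (hS.and hR))
  have hdet : (sinkhornIter X 0).det ≠ 0 :=
    sinkhornIter_det_ne_zero (det_ne_zero_of_colStochastic_of_half_lt (sinkhornIter_pos X _)
      (colSum_sinkhornIter_succ X K) σ fun i => by linarith [(hK (K + 1) (Nat.le_succ K)).2.1 i]) 0
  -- If the oscillation vanishes at step `K + 1`, invertibility carries double stochasticity back to
  -- the first iterate. Otherwise its slow decay from there on bounds `r` from below.
  by_cases hosc : osc (fun i => ∑ j, sinkhornIter X (K + 1) i j) ≤ 0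
  · exact Or.inl (rowSum_sinkhornIter_eq_one hdet (rowSum_sinkhornIter_eq_one_of_osc_nonpos hosc))
  right
  push Not at hosc
  have hq : (1 - 4 * η) ^ 2 ≤ r := by
    refine le_of_eventually_mul_le (o := fun k => osc fun i => ∑ j, sinkhornIter X (k + 1) i j)
      (C := 2 * (N * C) * r) (K := K) (pow_pos (by linarith) 2) hr0 hosc (fun k hk => ?_)
      fun k => ?_
    · have h1 := hK (k + 1) (by omega)
      exact osc_rowSum_sinkhornIter_ge σ hη0 (by linarith) h1.2.1 h1.2.2 h1.1
    · obtain ⟨i, j, ho, -⟩ := exists_osc_eq fun i => ∑ j, sinkhornIter X (k + 1) i j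
      have hb : ∀ i, |∑ j, sinkhornIter X (k + 1) i j - 1| ≤ N * (C * r ^ (k + 1)) := by
        intro i
        have hLi : ∑ j, L i j = 1 :=
          (mem_doublyStochastic_iff_sum.1 hL.mem_doublyStochastic).2.1 i
        rw [← hLi, ← Finset.sum_sub_distrib]
        calc |∑ j, (sinkhornIter X (k + 1) i j - L i j)|
            ≤ ∑ j, |sinkhornIter X (k + 1) i j - L i j| := Finset.abs_sum_le_sum_abs _ _
          _ ≤ ∑ _j : Fin N, C * r ^ (k + 1) := Finset.sum_le_sum fun j _ =>
              (abs_apply_le_frobenius_norm (sinkhornIter X (k + 1) - L) i j).trans (hC (k + 1))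
          _ = _ := by simp
      have hi := abs_le.1 (hb i)
      have hj := abs_le.1 (hb j)
      have e : 2 * (N * C) * r * r ^ k = 2 * (N * (C * r ^ (k + 1))) := by ring
      show osc _ ≤ _
      rw [ho, e]
      linarith [hi.2, hj.1]
  nlinarith

end RateLowerBound

/-! ### Marginal errors after finitely many steps -/

section Potential

variable {N : ℕ}

/-- Termwise, `log √x ≤ √x - 1` gives `(√x - 1) ^ 2 ≤ x - 1 - log x`; the linear part sums to zero.
-/
lemma sum_sq_sqrt_sub_one_le {x : Fin N → ℝ} (hx : ∀ i, 0 < x i) (hs : ∑ i, x i = N) :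
    ∑ i, (√(x i) - 1) ^ 2 ≤ -Real.log (∏ i, x i) := by
  rw [Real.log_prod fun i _ => (hx i).ne', ← Finset.sum_neg_distrib]
  have h1 : ∑ i, (√(x i) - 1) ^ 2 ≤ ∑ i, (x i - 1 - Real.log (x i)) := by
    refine Finset.sum_le_sum fun i _ => ?_
    have h2 := Real.log_le_sub_one_of_pos (Real.sqrt_pos.2 (hx i))
    rw [Real.log_sqrt (hx i).le] at h2
    have h3 := Real.sq_sqrt (hx i).le
    nlinarith
  refine h1.trans (le_of_eq ?_)
  simp [Finset.sum_sub_distrib, hs]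

/-- The logarithm of the product along `σ` is a Lyapunov function: both half-steps increase it, and
the gain of the row step dominates the marginal error. -/
lemma log_prod_sinkhornIter_succ_ge (X : Matrix (Fin N) (Fin N) ℝ) (σ : Equiv.Perm (Fin N))
    (k : ℕ) :
    ∑ i, (√(∑ j, sinkhornIter X (k + 1) i j) - 1) ^ 2 +
      Real.log (∏ i, sinkhornIter X (k + 1) i (σ i)) ≤
        Real.log (∏ i, sinkhornIter X (k + 2) i (σ i)) := by
  have hp := sinkhornIter_pos X (k + 1)
  have hp' : ∀ i j, 0 < (rowNormalize (sinkhornIter X (k + 1))).transpose i j :=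
    fun i j => rowNormalize_pos hp j i
  have hc : ∀ j, 0 < ∑ i, rowNormalize (sinkhornIter X (k + 1)) i j := rowSum_pos hp'
  have hcs : ∑ j, ∑ i, rowNormalize (sinkhornIter X (k + 1)) i j = N := by
    refine Finset.sum_comm.trans ?_
    simp [rowSum_rowNormalize hp]
  have h1 := sum_sq_sqrt_sub_one_le (rowSum_pos hp) (sum_rowSum_sinkhornIter_succ X k)
  have h2 := sum_sq_sqrt_sub_one_le hc hcs
  have h3 : 0 ≤ ∑ j, (√(∑ i, rowNormalize (sinkhornIter X (k + 1)) i j) - 1) ^ 2 := by positivity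
  have hP : ∏ i, sinkhornIter X (k + 1) i (σ i) ≠ 0 :=
    (Finset.prod_pos fun i _ => hp i (σ i)).ne'
  have hr0 : ∏ i, ∑ j, sinkhornIter X (k + 1) i j ≠ 0 :=
    (Finset.prod_pos fun i _ => rowSum_pos hp i).ne'
  have hc0 : ∏ j, ∑ i, rowNormalize (sinkhornIter X (k + 1)) i j ≠ 0 :=
    (Finset.prod_pos fun j _ => hc j).ne'
  rw [prod_sinkhornIter_succ X (k + 1), Real.log_div (div_ne_zero hP hr0) hc0,
    Real.log_div hP hr0]
  linarith

lemma sum_range_add_log_prod_le (X : Matrix (Fin N) (Fin N) ℝ) (σ : Equiv.Perm (Fin N)) (n : ℕ) :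
    ∑ k ∈ Finset.range n, ∑ i, (√(∑ j, sinkhornIter X (k + 1) i j) - 1) ^ 2 ≤
      -Real.log (∏ i, sinkhornIter X 1 i (σ i)) := by
  have h : ∑ k ∈ Finset.range n, ∑ i, (√(∑ j, sinkhornIter X (k + 1) i j) - 1) ^ 2 +
      Real.log (∏ i, sinkhornIter X 1 i (σ i)) ≤
        Real.log (∏ i, sinkhornIter X (n + 1) i (σ i)) := by
    induction n with
    | zero => simp
    | succ n ih =>
      rw [Finset.sum_range_succ]
      linarith [log_prod_sinkhornIter_succ_ge X σ n]
  have h1 : Real.log (∏ i, sinkhornIter X (n + 1) i (σ i)) ≤ 0 :=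
    Real.log_nonpos (Finset.prod_nonneg fun i _ => (sinkhornIter_pos X _ _ _).le)
      (Finset.prod_le_one (fun i _ => (sinkhornIter_pos X _ _ _).le)
        fun i _ => sinkhornIter_succ_le_one X n _ _)
  linarith

/-- By pigeonhole one of the first `k + 1` steps gains at most `d ^ 2`. Its row sums lie between `(1
- d) ^ 2` and `(1 + d) ^ 2`, and later iterates stay there. -/
lemma abs_rowSum_sinkhornIter_sub_one_le {X : Matrix (Fin N) (Fin N) ℝ} {σ : Equiv.Perm (Fin N)}
    {d : ℝ} (hd0 : 0 ≤ d) (hd1 : d < 1) {k : ℕ}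
    (h : -Real.log (∏ i, sinkhornIter X 1 i (σ i)) ≤ (k + 1) * d ^ 2) (i : Fin N) :
    |∑ j, sinkhornIter X (k + 1) i j - 1| ≤ 3 * d := by
  obtain ⟨l, hl, hle⟩ := Finset.exists_le_of_sum_le (s := Finset.range (k + 1))
    (f := fun l => ∑ i, (√(∑ j, sinkhornIter X (l + 1) i j) - 1) ^ 2) (g := fun _ => d ^ 2)
    (by simp) ((sum_range_add_log_prod_le X σ (k + 1)).trans (h.trans (by simp)))
  have hmem : ∀ i, ∑ j, sinkhornIter X (l + 1) i j ∈ Set.Icc ((1 - d) ^ 2) ((1 + d) ^ 2) := by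
    intro i
    have h1 : (√(∑ j, sinkhornIter X (l + 1) i j) - 1) ^ 2 ≤ d ^ 2 :=
      (Finset.single_le_sum (f := fun i => (√(∑ j, sinkhornIter X (l + 1) i j) - 1) ^ 2)
        (fun _ _ => sq_nonneg _) (Finset.mem_univ i)).trans hle
    have h2 := abs_le.1 (abs_le_of_sq_le_sq h1 hd0)
    rw [← Real.sq_sqrt (rowSum_pos (sinkhornIter_pos X (l + 1)) i).le]
    constructor <;> gcongr <;> linarith [h2.1, h2.2]
  have := rowSum_sinkhornIter_mem_of_le (pow_pos (by linarith) 2)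
    (pow_le_pow_left₀ (by linarith) (by linarith) 2) hmem
    (Nat.lt_succ_iff.1 (Finset.mem_range.1 hl)) i
  rw [abs_le]
  constructor <;> nlinarith [this.1, this.2]

lemma neg_log_prod_sinkhornIter_one_le {X : Matrix (Fin N) (Fin N) ℝ} {b : ℝ}
    (hb : ∀ i j, |X i j| ≤ b) (σ : Equiv.Perm (Fin N)) :
    -Real.log (∏ i, sinkhornIter X 1 i (σ i)) ≤ N * (2 * b + 2 * Real.log N) := by
  rw [Real.log_prod fun i _ => (sinkhornIter_pos X 1 i (σ i)).ne', ← Finset.sum_neg_distrib]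
  have key : ∀ i j, -Real.log (sinkhornIter X 1 i j) ≤ 2 * b + 2 * Real.log N := by
    intro i j
    have hN : (0 : ℝ) < N := by exact_mod_cast Fin.pos i
    have hp := sinkhornIter_pos X 0
    have hp' := rowNormalize_pos hp
    have hr : ∑ l, sinkhornIter X 0 i l ≤ N * Real.exp b := by
      calc ∑ l, sinkhornIter X 0 i l ≤ ∑ _l : Fin N, Real.exp b :=
            Finset.sum_le_sum fun l _ => Real.exp_le_exp.2 (abs_le.1 (hb i l)).2
        _ = _ := by simp
    have hc : ∑ l, rowNormalize (sinkhornIter X 0) l j ≤ N := by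
      calc ∑ l, rowNormalize (sinkhornIter X 0) l j ≤ ∑ _l : Fin N, (1 : ℝ) :=
            Finset.sum_le_sum fun l _ => by
              rw [← rowSum_rowNormalize hp l]
              exact Finset.single_le_sum (f := fun j => rowNormalize (sinkhornIter X 0) l j)
                (fun j _ => (hp' l j).le) (Finset.mem_univ j)
        _ = _ := by simp
    have hc0 : 0 < ∑ l, rowNormalize (sinkhornIter X 0) l j :=
      rowSum_pos (A := (rowNormalize (sinkhornIter X 0)).transpose) (fun i j => hp' j i) j
    have hr0 := rowSum_pos hp i
    have e : sinkhornIter X 1 i j = Real.exp (X i j) / (∑ l, sinkhornIter X 0 i l) /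
      ∑ l, rowNormalize (sinkhornIter X 0) l j := rfl
    have h1 := Real.log_le_log hr0 hr
    have h2 := Real.log_le_log hc0 hc
    rw [Real.log_mul hN.ne' (Real.exp_pos b).ne', Real.log_exp] at h1
    rw [e, Real.log_div (div_pos (Real.exp_pos _) hr0).ne' hc0.ne',
      Real.log_div (Real.exp_pos _).ne' hr0.ne', Real.log_exp]
    linarith [(abs_le.1 (hb i j)).1]
  calc ∑ i, -Real.log (sinkhornIter X 1 i (σ i)) ≤ ∑ _i : Fin N, (2 * b + 2 * Real.log N) :=
        Finset.sum_le_sum fun i _ => key i _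
    _ = _ := by simp [mul_add]

end Potential

/-! ### The limit of small temperatures -/

section SmallTemperature

variable {N : ℕ}

lemma tendsto_div_nhdsGT_zero_atTop {c : ℝ} (hc : 0 < c) :
    Tendsto (fun τ : ℝ => c / τ) (𝓝[>] 0) atTop :=
  tendsto_inv_nhdsGT_zero.const_mul_atTop hc

lemma sum_inv_smul_add_le {Y : Matrix (Fin N) (Fin N) ℝ} {σ π : Equiv.Perm (Fin N)} {g τ : ℝ}
    (hτ : 0 < τ) (h : ∑ i, Y i (π i) + g ≤ ∑ i, Y i (σ i)) :
    ∑ i, (τ⁻¹ • Y) i (π i) + g / τ ≤ ∑ i, (τ⁻¹ • Y) i (σ i) := by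
  simp only [Matrix.smul_apply, smul_eq_mul, ← Finset.mul_sum]
  rw [div_eq_inv_mul, ← mul_add]
  exact mul_le_mul_of_nonneg_left h (inv_pos.2 hτ).le

/-- The lower bound `1 - 8 * rateGap N g τ` holds for the rates of convergence at temperature `τ`,
where `g` is the gap between the best and the second best assignment. -/
noncomputable def rateGap (N : ℕ) (g τ : ℝ) : ℝ :=
  2 * (N.factorial * Real.exp (-(g / τ / N)))

lemma rateGap_pos (N : ℕ) (g τ : ℝ) : 0 < rateGap N g τ := by
  have := Nat.factorial_pos N
  unfold rateGap
  positivity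

/-- Exponential decay in `1 / τ` beats the linear growth of the Lyapunov budget. -/
lemma tendsto_mul_rateGap (hN : 0 < N) {g : ℝ} (hg : 0 < g) (b c : ℝ) :
    Tendsto (fun τ => (b / τ + c) * rateGap N g τ) (𝓝[>] 0) (𝓝 0) := by
  have hN' : (0 : ℝ) < N := by exact_mod_cast hN
  have hx : Tendsto (fun τ : ℝ => g / τ / N) (𝓝[>] 0) atTop :=
    (tendsto_div_nhdsGT_zero_atTop hg).atTop_div_const hN'
  have h1 := (Real.tendsto_pow_mul_exp_neg_atTop_nhds_zero 1).comp hx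
  have h0 := (Real.tendsto_pow_mul_exp_neg_atTop_nhds_zero 0).comp hx
  have h := (h1.const_mul (b * N / g * (2 * N.factorial))).add (h0.const_mul (c * (2 * N.factorial)))
  simp only [mul_zero, add_zero] at h
  refine h.congr fun τ => ?_
  simp only [Function.comp_apply, pow_one, pow_zero, rateGap]
  field_simp

/-- The `k + 1`-st iterate is doubly stochastic, or `k` is large compared with the temperature. -/
def IsLateIterate (Y : Matrix (Fin N) (Fin N) ℝ) (g τ : ℝ) (k : ℕ) : Prop :=
  (∀ i, ∑ j, sinkhornIter (τ⁻¹ • Y) (k + 1) i j = 1) ∨ 1 < 16 * rateGap N g τ * (k + 1)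

lemma eventually_norm_sub_le_of_isLateIterate (hN : 0 < N) {Y : Matrix (Fin N) (Fin N) ℝ}
    {σ : Equiv.Perm (Fin N)} {g : ℝ} (hg : 0 < g)
    (h : ∀ π, π ≠ σ → ∑ i, Y i (π i) + g ≤ ∑ i, Y i (σ i)) {e : ℝ} (he : 0 < e) :
    ∀ᶠ τ in 𝓝[>] (0 : ℝ), ∀ k, IsLateIterate Y g τ k →
      ‖σ.permMatrix ℝ - sinkhornIter (τ⁻¹ • Y) (k + 1)‖ ≤ e := by
  obtain ⟨δ, hδ, hS⟩ := exists_sum_sq_sub_le_of_approx σ (pow_pos he 2)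
  obtain ⟨B, hB⟩ : ∃ B, ∀ i j, |Y i j| ≤ B := by
    obtain ⟨B, hB⟩ := (Set.finite_range fun p : Fin N × Fin N => |Y p.1 p.2|).bddAbove
    exact ⟨B, fun i j => hB ⟨(i, j), rfl⟩⟩
  set d := min (δ / 3) (1 / 2)
  have hd0 : 0 < d := lt_min (by positivity) (by norm_num)
  have hexp : Tendsto (fun τ : ℝ => Real.exp (-(g / τ))) (𝓝[>] 0) (𝓝 0) :=
    Real.tendsto_exp_neg_atTop_nhds_zero.comp (tendsto_div_nhdsGT_zero_atTop hg)
  have hgap := tendsto_mul_rateGap hN hg (16 * (N * (2 * B))) (16 * (N * (2 * Real.log N)))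
  filter_upwards [hexp.eventually_le_const hδ, hgap.eventually_le_const (pow_pos hd0 2),
    self_mem_nhdsWithin] with τ hτ1 hτ2 hτ k hk
  have hτ : 0 < τ := hτ
  refine le_of_sq_le_sq ?_ he.le
  rw [frobenius_norm_sq]
  refine hS _ (fun i j => (sinkhornIter_pos _ _ i j).le) (sinkhornIter_succ_le_one _ k)
    (colSum_sinkhornIter_succ _ k) (fun i => ?_)
    fun π hπ => (prod_sinkhornIter_succ_le_exp (sum_inv_smul_add_le hτ (h π hπ)) k).trans hτ1
  rcases hk with hk | hk
  · rw [hk i]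
    simpa using hδ.le
  · have hb : ∀ i j, |(τ⁻¹ • Y) i j| ≤ B / τ := fun i j => by
      rw [Matrix.smul_apply, smul_eq_mul, abs_mul, abs_of_pos (inv_pos.2 hτ), div_eq_inv_mul]
      exact mul_le_mul_of_nonneg_left (hB i j) (inv_pos.2 hτ).le
    have h1 := neg_log_prod_sinkhornIter_one_le hb σ
    have h2 : (N : ℝ) * (2 * (B / τ) + 2 * Real.log N) ≤ (k + 1) * d ^ 2 := by
      -- Lateness means that `k + 1` exceeds `1 / (16 * rateGap N g τ)`, which is large compared
      -- with the budget of order `1 / τ`.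
      have hη := rateGap_pos N g τ
      have e1 : (16 * (N * (2 * B)) / τ + 16 * (N * (2 * Real.log N))) * rateGap N g τ =
          N * (2 * (B / τ) + 2 * Real.log N) * (16 * rateGap N g τ) := by ring
      rw [e1, ← le_div_iff₀ (by positivity)] at hτ2
      refine hτ2.trans ?_
      rw [div_le_iff₀ (by positivity)]
      nlinarith [pow_pos hd0 2]
    have h3 := abs_rowSum_sinkhornIter_sub_one_le hd0.le
      ((min_le_right _ _).trans_lt (by norm_num)) (h1.trans h2) i
    have h4 : d ≤ δ / 3 := min_le_left _ _
    linarith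

theorem exists_small_temperature_estimate {Y : Matrix (Fin N) (Fin N) ℝ}
    (hY : ∃! P, IsOptimalAssignment Y P) :
    ∃ s : ℝ → ℝ, Tendsto s (𝓝[>] 0) (𝓝 0) ∧
      ∃ (C : ℝ) (k₀ : ℕ) (τ₀ : ℝ), 0 < τ₀ ∧
        ∀ τ : ℝ, 0 < τ → τ < τ₀ → ∀ r : ℝ, IsSinkhornRate (τ⁻¹ • Y) r →
          ∀ k : ℕ, k₀ ≤ k → ∀ P : Matrix (Fin N) (Fin N) ℝ,
            IsOptimalAssignment (sinkhornIter (τ⁻¹ • Y) k) P →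
              ‖P - sinkhornIter (τ⁻¹ • Y) k‖ ^ 2 ≤ C * (s τ ^ 2 + r ^ (2 * k)) := by
  rcases Nat.eq_zero_or_pos N with rfl | hN
  · refine ⟨0, tendsto_const_nhds, 0, 0, 1, one_pos, fun τ _ _ r _ k _ P _ => ?_⟩
    rw [frobenius_norm_sq]
    simp
  obtain ⟨σ, g, hg, hgap⟩ := exists_gap hY
  -- The worst distance over all late iterates: independent of `r` and `k`, at most `N`, and zero if
  -- there are none.
  let s : ℝ → ℝ := fun τ => sSup {y | ∃ k, IsLateIterate Y g τ k ∧
    y = ‖σ.permMatrix ℝ - sinkhornIter (τ⁻¹ • Y) (k + 1)‖}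
  have hs0 : ∀ τ, 0 ≤ s τ := fun τ => Real.sSup_nonneg (by
    rintro _ ⟨k, -, rfl⟩
    exact norm_nonneg _)
  have hsle : ∀ τ k, IsLateIterate Y g τ k →
      ‖σ.permMatrix ℝ - sinkhornIter (τ⁻¹ • Y) (k + 1)‖ ≤ s τ := fun τ k hk =>
    le_csSup ⟨N, by
      rintro _ ⟨k, -, rfl⟩
      exact norm_permMatrix_sub_sinkhornIter_le _ k σ⟩ ⟨k, hk, rfl⟩
  have hs : Tendsto s (𝓝[>] 0) (𝓝 0) := by
    rw [Metric.tendsto_nhds]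
    intro e he
    filter_upwards [eventually_norm_sub_le_of_isLateIterate hN hg hgap (half_pos he)] with τ hτ
    rw [Real.dist_eq, sub_zero, abs_of_nonneg (hs0 τ)]
    refine lt_of_le_of_lt (Real.sSup_le ?_ (half_pos he).le) (half_lt_self he)
    rintro _ ⟨k, hk, rfl⟩
    exact hτ k hk
  have hη : ∀ᶠ τ in 𝓝[>] (0 : ℝ), rateGap N g τ ≤ 1 / 8 := by
    have := tendsto_mul_rateGap hN hg 0 1
    simp only [zero_div, zero_add, one_mul] at this
    exact this.eventually_le_const (by norm_num)
  obtain ⟨τ₀, hτ₀, hsub⟩ := mem_nhdsGT_iff_exists_Ioo_subset.1 hη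
  -- For iterates that are not late, `4 * N ^ 2` turns `r ^ (2 * k) ≥ 1 / 4` into the trivial bound
  -- `N ^ 2`. The start `k₀ = 1` is needed for column sums equal to one.
  refine ⟨s, hs, 4 * N ^ 2 + 1, 1, τ₀, hτ₀, fun τ hτ hττ₀ r hr k hk P hP => ?_⟩
  obtain ⟨k, rfl⟩ := Nat.exists_eq_add_of_le' hk
  have hr0 : 0 < r := hr.1
  have hητ : rateGap N g τ ≤ 1 / 8 := hsub ⟨hτ, hττ₀⟩
  refine (hP.norm_sub_sq_le σ).trans ?_
  have hrp : 0 ≤ r ^ (2 * (k + 1)) := by positivity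
  by_cases hlate : IsLateIterate Y g τ k
  · have h1 := pow_le_pow_left₀ (norm_nonneg _) (hsle τ k hlate) 2
    nlinarith [sq_nonneg (s τ), sq_nonneg (N : ℝ)]
  · simp only [IsLateIterate, not_or, not_lt] at hlate
    rcases hr.doublyStochastic_or_le (fun π hπ => sum_inv_smul_add_le hτ (hgap π hπ)) rfl hητ
      with hds | hle
    · exact absurd (hds k) hlate.1
    have hle' : 1 - 8 * rateGap N g τ ≤ r := hle
    -- Bernoulli: `r ^ (k + 1)` is at least `1 - 8 * rateGap N g τ * (k + 1)`, hence at least `1 /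
    -- 2`.
    have h1 := one_add_mul_le_pow (a := -(8 * rateGap N g τ)) (by linarith) (k + 1)
    have h2 : (1 + -(8 * rateGap N g τ)) ^ (k + 1) ≤ r ^ (k + 1) :=
      pow_le_pow_left₀ (by linarith) (by linarith) _
    push_cast at h1
    have h3 : 1 / 2 ≤ r ^ (k + 1) := by nlinarith [hlate.2]
    have h4 : 1 / 4 ≤ r ^ (2 * (k + 1)) := by
      rw [mul_comm, pow_mul]
      nlinarith
    have h5 := pow_le_pow_left₀ (norm_nonneg _)
      (norm_permMatrix_sub_sinkhornIter_le (τ⁻¹ • Y) k σ) 2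
    nlinarith [sq_nonneg (s τ), sq_nonneg (N : ℝ)]

end SmallTemperature

theorem lemma1 {N : ℕ} (X : Matrix (Fin N) (Fin N) ℝ)
    {Ω : Type*} [MeasurableSpace Ω] (μ : Measure Ω) [IsProbabilityMeasure μ]
    (ε : Fin N → Fin N → Ω → ℝ)
    (hε : ∀ i j, IsStandardGumbel (ε i j) μ)
    (hindep : iIndepFun (fun p : Fin N × Fin N => ε p.1 p.2) μ) :
    -- with Gumbel noise, the optimal assignment is almost surely unique
    (∀ᵐ ω ∂μ, ∃! P, IsOptimalAssignment (X + Matrix.of fun i j => ε i j ω) P) ∧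
    -- the estimate, for every matrix (noisy or not) whose optimal assignment is unique
    ∀ Y : Matrix (Fin N) (Fin N) ℝ, (∃! P, IsOptimalAssignment Y P) →
      (∀ τ : ℝ, 0 < τ → ∃ r, IsSinkhornRate (τ⁻¹ • Y) r) ∧
      ∃ s : ℝ → ℝ, Tendsto s (𝓝[>] 0) (𝓝 0) ∧
        ∃ (C : ℝ) (k₀ : ℕ) (τ₀ : ℝ), 0 < τ₀ ∧
          ∀ τ : ℝ, 0 < τ → τ < τ₀ → ∀ r : ℝ, IsSinkhornRate (τ⁻¹ • Y) r →
            ∀ k : ℕ, k₀ ≤ k → ∀ Preal : Matrix (Fin N) (Fin N) ℝ,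
              IsOptimalAssignment (sinkhornIter (τ⁻¹ • Y) k) Preal →
                ‖Preal - sinkhornIter (τ⁻¹ • Y) k‖ ^ 2 ≤ C * (s τ ^ 2 + r ^ (2 * k)) :=
  ⟨ae_existsUnique_isOptimalAssignment X μ ε hε hindep, fun Y hY =>
    ⟨fun τ _ => exists_isSinkhornRate (τ⁻¹ • Y), exists_small_temperature_estimate hY⟩⟩
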